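/- Let $m\ge 2$, $k=2m$. Let $\Gamma_k\le \mathrm{PSL}(2,\mathbb R)$ be the $(2,k,\infty)$ Hecke group, generated by (the classes of) $A=\begin{pmatrix}0&-1\\1&0\end{pmatrix}$ and $B=\begin{pmatrix}0&-1\\1&2\cos(\pi/k)\end{pmatrix}$, and let $X_k=\mathbb H/\Gamma_k$ be the Hecke surface, whose cone points of order $2$ and $k$ are the images of the fixed points of $A$ and of $B$ in the upper half-plane $\mathbb H$. A reciprocal geodesic based at a cone point $p$ of even order is the $\Gamma_k$-conjugacy class $\gamma$ of a hyperbolic element of $\Gamma_k$ that is the product of two distinct involutions of $\Gamma_k$ which are conjugate in $\Gamma_k$ and whose fixed points in $\mathbb H$ project to $p$. Its length $|\gamma|$ is the least word length, with respect to $\{A,B,B^{-1}\}$, of an element of the class. Let $R^{(2)}_{2t}$ and $R^{(k)}_{2t}$ be the sets of reciprocal geodesics of length $2t$ based at the cone point of order $2$, respectively of order $k$. The polynomial $$Q_{2m}(x)=x^{m+1}-2x^{m-1}-2x^{m-2}-\dots-2x-1$$ has a unique positive root $\beta_{2m}$. Let $N_t$ and $N'_t$ be the solutions of the linear recurrence $$y_t=2y_{t-2}+2y_{t-3}+\dots+2y_{t-m}+y_{t-(m+1)}$$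 where * for $N$: the recurrence holds for $t>m+2$, and $N_t=\frac13(2^t+2(-1)^t)$ for $2\le t<m+1$, $N_{m+1}=\frac13(2^{m+1}+2(-1)^{m+1})-1$, $N_{m+2}=\frac13(2^{m+2}+2(-1)^{m+2})-2$; * for $N'$: the recurrence holds for $t>m+3$, and $N'_t=0$ for $t\le m$, $N'_{m+1}=1$, $N'_{m+2}=0$, $N'_{m+3}=2$. There are unique real numbers $d_{2m}$ and $e_{2m}$ which are the coefficients of $\beta_{2m}^t$ when $N_t$ (for $t\ge2$), respectively $N'_t$ (for $t\ge m+1$), is written as a linear combination of the $t$-th powers of the complex roots of $Q_{2m}$; both are positive. Moreover, as $t\to\infty$, $$\frac{|R^{(k)}_{2t}|}{|R^{(2)}_{2t}|}\longrightarrow \frac{e_{2m}}{d_{2m}},\qquad \frac{|R^{(2)}_{2t}\cup R^{(k)}_{2t}|}{\beta_{2m}^{\,t}}\longrightarrow\frac{d_{2m}+e_{2m}}2 .$$ -/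

import Mathlib

open Filter Topology Polynomial
open scoped MatrixGroups UpperHalfPlane

noncomputable section

namespace Hecke

/-- The Möbius action of `PSL(2, ℝ)` on the upper half-plane, induced by that of `SL(2, ℝ)`
(the centre consists of `± 1`, which acts trivially). -/
instance mulActionPSL : MulAction PSL(2, ℝ) ℍ :=
  MulAction.compHom ℍ
    (QuotientGroup.lift (Subgroup.center SL(2, ℝ)) (MulAction.toPermHom SL(2, ℝ) ℍ) (by
      intro M hM
      obtain ⟨r, hr, hM'⟩ := Matrix.SpecialLinearGroup.mem_center_iff.mp hM
      have hr0 : r ≠ 0 := by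
        rintro rfl
        simp at hr
      have h00 : M 0 0 = r := by
        have h := congrFun (congrFun hM' 0) 0
        simpa using h.symm
      have h01 : M 0 1 = 0 := by
        have h := congrFun (congrFun hM' 0) 1
        simpa using h.symm
      have h10 : M 1 0 = 0 := by
        have h := congrFun (congrFun hM' 1) 0
        simpa using h.symm
      have h11 : M 1 1 = r := by
        have h := congrFun (congrFun hM' 1) 1
        simpa using h.symm
      ext z
      have hrC : (r : ℂ) ≠ 0 := by exact_mod_cast hr0
      simp [UpperHalfPlane.coe_specialLinearGroup_apply, h00, h01, h10, h11, hrC]))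

theorem mk_smul (M : SL(2, ℝ)) (z : ℍ) : (QuotientGroup.mk M : PSL(2, ℝ)) • z = M • z := rfl

/-- The matrix `(0, -1; 1, 0)`. -/
def matA : SL(2, ℝ) := ⟨!![0, -1; 1, 0], by simp [Matrix.det_fin_two]⟩

/-- The matrix `(0, -1; 1, 2 cos (π / k))`. -/
def matB (k : ℕ) : SL(2, ℝ) :=
  ⟨!![0, -1; 1, 2 * Real.cos (Real.pi / k)], by simp [Matrix.det_fin_two]⟩

/-- The generator of order two of the Hecke groups. -/
def genA : PSL(2, ℝ) := QuotientGroup.mk matA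

/-- The generator of order `k` of the `(2, k, ∞)` Hecke group. -/
def genB (k : ℕ) : PSL(2, ℝ) := QuotientGroup.mk (matB k)

/-- The `(2, k, ∞)` Hecke group `Γ_k`, the subgroup of `PSL(2, ℝ)` generated by `A` and `B`. -/
def heckeGroup (k : ℕ) : Subgroup PSL(2, ℝ) := Subgroup.closure {genA, genB k}

/-- The Hecke surface `X_k = ℍ / Γ_k`, as a set of points. -/
abbrev Surface (k : ℕ) : Type := MulAction.orbitRel.Quotient (heckeGroup k) ℍ

/-- The projection `ℍ → X_k`. -/
def proj (k : ℕ) (z : ℍ) : Surface k := Quotient.mk _ z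

/-- The fixed point `-cos (π / k) + i sin (π / k)` of `B` in the upper half-plane. -/
def fixB (k : ℕ) (hk : 3 ≤ k) : ℍ :=
  ⟨⟨-Real.cos (Real.pi / k), Real.sin (Real.pi / k)⟩, by
    have hk' : (3 : ℝ) ≤ k := by exact_mod_cast hk
    refine Real.sin_pos_of_pos_of_lt_pi (by positivity) ?_
    exact div_lt_self Real.pi_pos (by linarith)⟩

theorem genA_smul_I : genA • UpperHalfPlane.I = UpperHalfPlane.I := by
  rw [genA, mk_smul]
  ext
  rw [UpperHalfPlane.coe_specialLinearGroup_apply]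
  simp [matA]

theorem genB_smul_fixB (k : ℕ) (hk : 3 ≤ k) : genB k • fixB k hk = fixB k hk := by
  rw [genB, mk_smul]
  have hs : Real.sin (Real.pi / k) ≠ 0 := (fixB k hk).im_pos.ne'
  have h := Real.sin_sq_add_cos_sq (Real.pi / k)
  have hne : ((fixB k hk : ℍ) : ℂ) + ((2 * Real.cos (Real.pi / k) : ℝ) : ℂ) ≠ 0 := by
    intro h0
    apply hs
    have h1 := congrArg Complex.im h0
    rw [Complex.add_im, Complex.ofReal_im, Complex.zero_im, add_zero] at h1
    exact h1
  ext
  rw [UpperHalfPlane.coe_specialLinearGroup_apply]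
  have e : (((matB k) 0 0 : ℝ) : ℂ) * (fixB k hk : ℂ) + (((matB k) 0 1 : ℝ) : ℂ) = -1 := by
    simp [matB]
  have e' : (((matB k) 1 0 : ℝ) : ℂ) * (fixB k hk : ℂ) + (((matB k) 1 1 : ℝ) : ℂ)
      = (fixB k hk : ℂ) + ((2 * Real.cos (Real.pi / k) : ℝ) : ℂ) := by
    simp [matB]
  simp only [Algebra.algebraMap_self, RingHom.id_apply]
  rw [e, e', div_eq_iff hne]
  apply Complex.ext
  · simp only [fixB, Complex.add_re, Complex.mul_re, Complex.neg_re, Complex.one_re,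
      Complex.ofReal_re, Complex.ofReal_im, Complex.add_im]
    nlinarith
  · simp only [fixB, Complex.add_re, Complex.mul_im, Complex.neg_im, Complex.one_im,
      Complex.ofReal_re, Complex.ofReal_im, Complex.add_im]
    ring

/-- The order `2` cone point of `X_k`: the image of the fixed point `i` of `A`. -/
def conePointTwo (k : ℕ) : Surface k := proj k UpperHalfPlane.I

/-- The order `k` cone point of `X_k`: the image of the fixed point of `B`. -/
def conePointK (k : ℕ) (hk : 3 ≤ k) : Surface k := proj k (fixB k hk)

/-- An element of `PSL(2, ℝ)` is hyperbolic if it is represented by a hyperbolic matrix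
(that is, one with `tr ^ 2 > 4`). -/
def IsHyperbolic (g : PSL(2, ℝ)) : Prop :=
  ∃ M : SL(2, ℝ), (QuotientGroup.mk M : PSL(2, ℝ)) = g ∧ (M : Matrix (Fin 2) (Fin 2) ℝ).IsHyperbolic

/-- All the fixed points of `g` in the upper half-plane project to `p`, and there is one. -/
def FixesOver {k : ℕ} (p : Surface k) (g : heckeGroup k) : Prop :=
  (∃ z : ℍ, g • z = z) ∧ ∀ z : ℍ, g • z = z → proj k z = p

/-- Reciprocal hyperbolic elements based at `p`: the hyperbolic elements of `Γ_k` which are the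
product of two distinct involutions, conjugate in `Γ_k`, whose fixed points project to `p`. -/
def IsReciprocalElement {k : ℕ} (p : Surface k) (w : heckeGroup k) : Prop :=
  IsHyperbolic (w : PSL(2, ℝ)) ∧
    ∃ u v : heckeGroup k, orderOf u = 2 ∧ orderOf v = 2 ∧ u ≠ v ∧ IsConj u v ∧
      FixesOver p u ∧ FixesOver p v ∧ w = u * v

/-- Reciprocal geodesics based at `p`: a closed geodesic on `X_k` is given by the conjugacy class
of a hyperbolic element of `Γ_k`, and is reciprocal at `p` if that element is. -/
def reciprocalGeodesics {k : ℕ} (p : Surface k) : Set (ConjClasses (heckeGroup k)) :=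
  {γ | ∃ w : heckeGroup k, ConjClasses.mk w = γ ∧ IsReciprocalElement p w}

/-- All reciprocal geodesics on `X_k`, `k` even: those based at one of the two cone points (both
of which have even order). -/
def allReciprocalGeodesics (k : ℕ) (hk : 3 ≤ k) : Set (ConjClasses (heckeGroup k)) :=
  reciprocalGeodesics (conePointTwo k) ∪ reciprocalGeodesics (conePointK k hk)

/-- The word length in `Γ_k` with respect to `{A, B, B⁻¹}`. -/
def wordLength {k : ℕ} (g : heckeGroup k) : ℕ :=
  sInf {n | ∃ l : List PSL(2, ℝ), (∀ x ∈ l, x = genA ∨ x = genB k ∨ x = (genB k)⁻¹) ∧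
    l.prod = (g : PSL(2, ℝ)) ∧ l.length = n}

/-- The length `|γ|` of a conjugacy class: the least word length of its elements. -/
def classLength {k : ℕ} (γ : ConjClasses (heckeGroup k)) : ℕ :=
  sInf {n | ∃ g : heckeGroup k, ConjClasses.mk g = γ ∧ wordLength g = n}

/-- The number of elements of length `n` in a set of conjugacy classes. -/
def countOfLength {k : ℕ} (R : Set (ConjClasses (heckeGroup k))) (n : ℕ) : ℕ :=
  Set.ncard {γ | γ ∈ R ∧ classLength γ = n}

/-- The polynomial `x ^ (m + 1) - 2 x ^ (m - 1) - 2 x ^ (m - 2) - ⋯ - 2 x - 1`. -/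
def heckePoly (R : Type) [CommRing R] (m : ℕ) : R[X] :=
  X ^ (m + 1) - (∑ j ∈ Finset.Icc 1 (m - 1), 2 * X ^ j) - 1

/-- The sequence `|N_{2t}|` (in `t`) for normal forms based at the order `2` cone point. -/
def seqTwo (m : ℕ) (t : ℕ) : ℝ :=
  if t < 2 then 0
  else if t < m + 1 then (2 ^ t + 2 * (-1) ^ t) / 3
  else if t = m + 1 then (2 ^ t + 2 * (-1) ^ t) / 3 - 1
  else if t = m + 2 then (2 ^ t + 2 * (-1) ^ t) / 3 - 2
  else (∑ j : Fin (m - 1), 2 * seqTwo m (t - (j + 2))) + seqTwo m (t - (m + 1))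
termination_by t
decreasing_by all_goals omega

/-- The sequence `|N_{2t}|` (in `t`) for normal forms based at the order `2 m` cone point. -/
def seqK (m : ℕ) (t : ℕ) : ℝ :=
  if t < m + 1 then 0
  else if t = m + 1 then 1
  else if t = m + 2 then 0
  else if t = m + 3 then 2
  else (∑ j : Fin (m - 1), 2 * seqK m (t - (j + 2))) + seqK m (t - (m + 1))
termination_by t
decreasing_by all_goals omega

/-- `c` is the coefficient of `β ^ t` when the sequence `N` is written, for `t ≥ t₀`, as a linear
combination of the powers `λ ^ t` of the complex roots `λ` of the characteristic polynomial. -/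
def IsCoefficient (m : ℕ) (N : ℕ → ℝ) (t₀ : ℕ) (β c : ℝ) : Prop :=
  ∃ a : ℂ → ℂ, a β = c ∧
    ∀ t : ℕ, t₀ ≤ t → (N t : ℂ) = ∑ z ∈ (heckePoly ℂ m).roots.toFinset, a z * z ^ t

end Hecke

end

open Hecke

/-!
Let `a = A`, `b = B`. Every element of the Hecke group is an alternating product of `a` and
nontrivial powers of `b` (`exists_normalForm`), and the matrices `-A * B ^ j`, `0 < j < k`, have
nonnegative entries, so that a nonempty product of syllables `a * b ^ x` is neither `1` nor `a`.
Hence the group is a free product and acts wherever `ℤ/2` and `ℤ/k` act (`exists_hom`).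

The group is made to act on tapes `ℤ → ℤ/k` with a head (`State`): `a` moves the head by one step,
`b` adds `1` at the head. A word with list of exponents `I` translates the periodic tape with
period `I`. As any element changes only finitely much of a tape, conjugate words have the same
periodic tape up to a shift (`periodic_eq_of_isConj`). Also, a letter raises a suitable potential
of a state by at most one, while a conjugate of the word raises it by the weight of `I`; this
computes the length of a class (`weight_le_length`, `classLength_wordClass`).

An involution of `PSL(2, ℝ)` is determined by its fixed point, and the product of two distinct
involutions is hyperbolic. So the reciprocal geodesics at the two cone points are the classes of
`g * c * g⁻¹ * c`, with `c = A` or `c = B ^ m`, and the normal form turns them into words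
`l ++ l*` and `m :: l ++ m :: l*`, where `l*` is the reversed list of negatives
(`mem_reciprocal_two_iff`, `mem_reciprocal_k_iff`). Comparing the symmetries of the periodic tapes
shows that `l` and `l*` give the same class, that there are no other coincidences except among
lists with `l = l*`, and that a geodesic reciprocal at both cone points has `l = l*`. The lists of
weight `t` are counted by `N t` at the order two point, those of weight `t - (m + 1)` by `N' t` at
the other one (`seqTwo_eq_card_words`, `seqK_eq_cardWordsSub`), and symmetric lists are determined
by a half, so there are only `O (β ^ (t / 2))` of them. Up to this error the counts are `N t / 2`
and `N' t / 2`.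

Finally `(x - 1) * Q(x) = (x + 1) * (x ^ m * (x - 2) + 1)`, which shows that the roots of `Q` are
simple and that the positive root `β` exceeds the modulus of every other root. Hence `N t / β ^ t`
and `N' t / β ^ t` converge to the leading coefficients.
-/

namespace Hecke

/-! ### The characteristic polynomial -/

theorem eval_heckePoly {R : Type} [CommRing R] (m : ℕ) (x : R) :
    (heckePoly R m).eval x = x ^ (m + 1) - (∑ j ∈ Finset.Icc 1 (m - 1), 2 * x ^ j) - 1 := by
  simp [heckePoly, eval_finsetSum]

theorem isRoot_heckePoly_iff {R : Type} [CommRing R] {m : ℕ} {x : R} :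
    (heckePoly R m).IsRoot x ↔ x ^ (m + 1) = (∑ j ∈ Finset.Icc 1 (m - 1), 2 * x ^ j) + 1 := by
  rw [IsRoot.def, eval_heckePoly, sub_sub, sub_eq_zero]

/-- Up to the factors `x - 1` and `x + 1`, the polynomial is `x ^ m * (x - 2) + 1`. -/
theorem sub_one_mul_heckePoly {R : Type} [CommRing R] {m : ℕ} (hm : 2 ≤ m) :
    (X - 1) * heckePoly R m = (X + 1) * (X ^ m * (X - 2) + 1) := by
  obtain ⟨n, rfl⟩ : ∃ n, m = n + 1 := ⟨m - 1, by omega⟩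
  have h : ∀ k : ℕ, (X - 1) * (∑ j ∈ Finset.Icc 1 k, 2 * X ^ j : R[X])
      = 2 * X ^ (k + 1) - 2 * X := by
    intro k
    induction k with
    | zero => simp
    | succ k ih => rw [Finset.sum_Icc_succ_top (by omega), mul_add, ih]; ring
  rw [heckePoly, Nat.add_sub_cancel, mul_sub, mul_sub, h n]
  ring

theorem root_dichotomy {K : Type} [Field K] {m : ℕ} (hm : 2 ≤ m) {z : K}
    (hz : (heckePoly K m).IsRoot z) : z = -1 ∨ z ^ m * (2 - z) = 1 := by
  have h := congrArg (eval z) (sub_one_mul_heckePoly (R := K) hm)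
  rw [eval_mul, hz.eq_zero, mul_zero, eval_mul] at h
  simp only [eval_add, eval_X, eval_one, eval_mul, eval_pow, eval_sub, eval_ofNat] at h
  rcases mul_eq_zero.mp h.symm with h | h
  · left; linear_combination h
  · right; linear_combination -h

/-- Past a point where the polynomial is nonnegative, it is positive. -/
theorem eval_heckePoly_pos_of_lt {m : ℕ} {x y : ℝ} (hx : 0 < x) (hxy : x < y)
    (h : 0 ≤ (heckePoly ℝ m).eval x) : 0 < (heckePoly ℝ m).eval y := by
  rw [eval_heckePoly] at h ⊢
  obtain ⟨q, hq, rfl⟩ : ∃ q : ℝ, 1 < q ∧ y = q * x :=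
    ⟨y / x, (one_lt_div hx).mpr hxy, by field_simp⟩
  have h1 : (∑ j ∈ Finset.Icc 1 (m - 1), 2 * (q * x) ^ j)
      ≤ q ^ (m + 1) * ∑ j ∈ Finset.Icc 1 (m - 1), 2 * x ^ j := by
    rw [Finset.mul_sum]
    refine Finset.sum_le_sum fun j hj => ?_
    have : q ^ j ≤ q ^ (m + 1) :=
      pow_le_pow_right₀ hq.le (by have := (Finset.mem_Icc.mp hj).2; omega)
    have hp : 0 < x ^ j := by positivity
    rw [mul_pow]
    nlinarith
  have h2 : 1 < q ^ (m + 1) := one_lt_pow₀ hq (by omega)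
  have h3 : 0 ≤ q ^ (m + 1) * (x ^ (m + 1) - (∑ j ∈ Finset.Icc 1 (m - 1), 2 * x ^ j) - 1) :=
    mul_nonneg (by positivity) h
  rw [mul_pow]
  linarith

theorem eval_heckePoly_one_neg {m : ℕ} (hm : 2 ≤ m) : (heckePoly ℝ m).eval 1 < 0 := by
  rw [eval_heckePoly]
  simp
  omega

theorem eval_heckePoly_two_pos {m : ℕ} (hm : 2 ≤ m) : 0 < (heckePoly ℝ m).eval 2 := by
  have h := congrArg (eval 2) (sub_one_mul_heckePoly (R := ℝ) hm)
  simp at h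
  linarith

theorem exists_heckePoly_root {m : ℕ} (hm : 2 ≤ m) : ∃ β : ℝ, 0 < β ∧ (heckePoly ℝ m).IsRoot β := by
  obtain ⟨β, hβ, h⟩ := intermediate_value_Icc (f := fun x => (heckePoly ℝ m).eval x)
    (show (1 : ℝ) ≤ 2 by norm_num) (heckePoly ℝ m).continuous.continuousOn
    (show (0 : ℝ) ∈ _ from ⟨(eval_heckePoly_one_neg hm).le, (eval_heckePoly_two_pos hm).le⟩)
  exact ⟨β, by linarith [hβ.1], h⟩

theorem heckePoly_root_unique {m : ℕ} {x y : ℝ} (hx : 0 < x) (hy : 0 < y)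
    (hx' : (heckePoly ℝ m).IsRoot x) (hy' : (heckePoly ℝ m).IsRoot y) : x = y := by
  rcases lt_trichotomy x y with h | h | h
  · exact absurd hy'.eq_zero (eval_heckePoly_pos_of_lt hx h hx'.eq_zero.ge).ne'
  · exact h
  · exact absurd hx'.eq_zero (eval_heckePoly_pos_of_lt hy h hy'.eq_zero.ge).ne'

theorem one_lt_root {m : ℕ} (hm : 2 ≤ m) {β : ℝ} (hβ : 0 < β) (h : (heckePoly ℝ m).IsRoot β) :
    1 < β := by
  by_contra! hle
  rcases hle.lt_or_eq with hlt | rfl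
  · linarith [eval_heckePoly_pos_of_lt hβ hlt h.eq_zero.ge, eval_heckePoly_one_neg hm]
  · linarith [h.eq_zero, eval_heckePoly_one_neg hm]

theorem root_lt_two {m : ℕ} (hm : 2 ≤ m) {β : ℝ} (hβ : 0 < β) (h : (heckePoly ℝ m).IsRoot β) :
    β < 2 := by
  rcases root_dichotomy hm h with h | h
  · linarith
  · by_contra! hle
    nlinarith [pow_pos hβ m]

/-- The positive root strictly dominates the other complex roots. -/
theorem norm_lt_of_isRoot {m : ℕ} (hm : 2 ≤ m) {β : ℝ} (hβ : 0 < β)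
    (h : (heckePoly ℝ m).IsRoot β) {z : ℂ} (hz : (heckePoly ℂ m).IsRoot z) (hne : z ≠ β) :
    ‖z‖ < β := by
  have hle : ‖z‖ ≤ β := by
    by_contra! hlt
    have hpos := eval_heckePoly_pos_of_lt hβ hlt h.eq_zero.ge
    rw [eval_heckePoly] at hpos
    have h1 := congrArg norm (isRoot_heckePoly_iff.mp hz)
    rw [norm_pow] at h1
    have h2 : ‖(∑ j ∈ Finset.Icc 1 (m - 1), 2 * z ^ j) + 1‖
        ≤ (∑ j ∈ Finset.Icc 1 (m - 1), 2 * ‖z‖ ^ j) + 1 := by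
      refine (norm_add_le _ _).trans ?_
      rw [norm_one]
      gcongr
      refine (norm_sum_le _ _).trans (le_of_eq ?_)
      simp
    linarith
  refine hle.lt_of_ne fun heq => hne ?_
  have hβ1 := one_lt_root hm hβ h
  have hβ2 := root_lt_two hm hβ h
  rcases root_dichotomy hm hz with hz1 | hz1
  · rw [hz1] at heq
    simp at heq
    linarith
  · have hb : β ^ m * (2 - β) = 1 := (root_dichotomy hm h).resolve_left (by linarith)
    have h1 := congrArg norm hz1
    rw [norm_mul, norm_pow, heq, norm_one, ← hb] at h1
    -- `|2 - z| = 2 - |z|` is equality in the triangle inequality, so `z` is its own modulus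
    have h2 : ‖2 - z‖ = 2 - β := mul_left_cancel₀ (pow_pos hβ m).ne' h1
    have h3 : ‖2 - z‖ ^ 2 = (2 - z.re) ^ 2 + z.im ^ 2 := by
      rw [← Complex.normSq_eq_norm_sq, Complex.normSq_apply]; simp; ring
    have h4 : ‖z‖ ^ 2 = z.re ^ 2 + z.im ^ 2 := by
      rw [← Complex.normSq_eq_norm_sq, Complex.normSq_apply]; ring
    rw [h2] at h3
    rw [heq] at h4
    have hre : z.re = β := by nlinarith
    have him : z.im = 0 := by
      rw [hre] at h4
      have : z.im ^ 2 = 0 := by linarith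
      simpa using this
    exact Complex.ext (by simp [hre]) (by simp [him])

theorem monic_and_natDegree_heckePoly {R : Type} [CommRing R] [Nontrivial R] {m : ℕ} (hm : 2 ≤ m) :
    (heckePoly R m).Monic ∧ (heckePoly R m).natDegree = m + 1 := by
  have hd : ((∑ j ∈ Finset.Icc 1 (m - 1), 2 * X ^ j : R[X]) + 1).degree < (m + 1 : ℕ) := by
    refine (degree_add_le _ _).trans_lt (max_lt ?_ ?_)
    · refine (degree_sum_le _ _).trans_lt ?_
      rw [Finset.sup_lt_iff (WithBot.bot_lt_coe _)]
      intro j hj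
      have : (2 * X ^ j : R[X]) = C 2 * X ^ j := rfl
      rw [this]
      refine (degree_C_mul_X_pow_le _ _).trans_lt ?_
      have := (Finset.mem_Icc.mp hj).2
      exact_mod_cast (by omega : j < m + 1)
    · rw [degree_one]; exact_mod_cast Nat.succ_pos m
  rw [heckePoly, sub_sub]
  refine ⟨monic_X_pow_sub hd, ?_⟩
  exact natDegree_eq_of_degree_eq_some (by
    rw [degree_sub_eq_left_of_degree_lt (by rwa [degree_X_pow]), degree_X_pow])

theorem two_mul_div_pow_ne {m : ℕ} (hm : 2 ≤ m) :
    ((2 * m / (m + 1) : ℝ)) ^ m * (2 - 2 * m / (m + 1)) ≠ 1 := by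
  intro h
  have hm' : (2 : ℝ) ≤ m := by exact_mod_cast hm
  have h1 := one_add_mul_le_pow (a := ((m - 1) / (m + 1) : ℝ))
    (by have : (0 : ℝ) ≤ (m - 1) / (m + 1) := div_nonneg (by linarith) (by linarith)
        linarith) m
  have e : (1 + (m - 1) / (m + 1) : ℝ) = 2 * m / (m + 1) := by field_simp; ring
  rw [e] at h1
  have e2 : (2 - 2 * m / (m + 1) : ℝ) = 2 / (m + 1) := by field_simp; ring
  rw [e2] at h
  have h2 : ((2 * m / (m + 1) : ℝ)) ^ m = (m + 1) / 2 := by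
    field_simp at h ⊢; linarith
  rw [h2] at h1
  have h3 : (1 + m * ((m - 1) / (m + 1)) : ℝ) = (m ^ 2 + 1) / (m + 1) := by field_simp; ring
  rw [h3, div_le_div_iff₀ (by linarith) (by norm_num)] at h1
  nlinarith

/-- The complex roots are simple: `-1` is a simple root, and a double root other than `-1` would
have to be the critical point `2 m / (m + 1)` of `x ^ m * (x - 2)`, which Bernoulli's inequality
excludes. -/
theorem nodup_roots_heckePoly {m : ℕ} (hm : 2 ≤ m) : (heckePoly ℂ m).roots.Nodup := by
  classical
  have h0 : heckePoly ℂ m ≠ 0 := (monic_and_natDegree_heckePoly hm).1.ne_zero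
  rw [Multiset.nodup_iff_count_le_one]
  intro z
  rw [count_roots]
  by_contra! hlt
  obtain ⟨hz, hz'⟩ := (one_lt_rootMultiplicity_iff_isRoot h0).mp hlt
  have h1 := congrArg (fun p => eval z (derivative p)) (sub_one_mul_heckePoly (R := ℂ) hm)
  have h2 := congrArg (eval z) (sub_one_mul_heckePoly (R := ℂ) hm)
  rw [derivative_mul] at h1
  simp [hz.eq_zero, hz'.eq_zero] at h1 h2
  obtain ⟨n, rfl⟩ : ∃ n, m = n + 1 := ⟨m - 1, by omega⟩
  rcases h2 with h2 | h2
  · have hz1 : z = -1 := by linear_combination h2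
    subst hz1
    have h3 : ((-1 : ℂ)) ^ (n + 1) = 1 ∨ ((-1 : ℂ)) ^ (n + 1) = -1 := neg_one_pow_eq_or ℂ _
    norm_num at h1
    rcases h3 with h3 | h3 <;> rw [h3] at h1 <;> norm_num at h1
  · rw [h2, zero_add] at h1
    have hz0 : z ≠ 0 := by
      rintro rfl
      simp at h2
    have hz1 : z + 1 ≠ 0 := by
      intro h
      have hz1 : z = -1 := by linear_combination h
      subst hz1
      have h3 : ((-1 : ℂ)) ^ (n + 1) = 1 ∨ ((-1 : ℂ)) ^ (n + 1) = -1 := neg_one_pow_eq_or ℂ _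
      rcases h3 with h3 | h3 <;> rw [h3] at h2 <;> norm_num at h2
    have h5 : z ^ n * ((n + 1 + 1) * z - 2 * (n + 1)) = 0 := by
      rw [derivative_X_pow] at h1
      simp [hz1] at h1
      linear_combination h1
    have h6 := (mul_eq_zero.mp h5).resolve_left (pow_ne_zero _ hz0)
    have hn : ((n : ℂ) + 1 + 1) ≠ 0 := by exact_mod_cast (Nat.succ_ne_zero (n + 1))
    have h7 : z = ((2 * (n + 1 : ℕ) / ((n + 1 : ℕ) + 1) : ℝ) : ℂ) := by
      push_cast
      rw [eq_div_iff hn]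
      linear_combination h6
    apply two_mul_div_pow_ne hm
    rw [h7] at h2
    generalize (2 * (n + 1 : ℕ) / ((n + 1 : ℕ) + 1) : ℝ) = w at h2 ⊢
    have h8 : w ^ (n + 1) * (w - 2) + 1 = 0 := by
      apply Complex.ofReal_injective
      push_cast
      exact h2
    linarith

/-! ### Linear recurrences -/

/-- A sequence satisfying the recurrence is a combination of powers of the characteristic roots. -/
theorem exists_coefficients {m : ℕ} (hm : 2 ≤ m) (W : ℕ → ℝ)
    (hW : ∀ t, W (t + m + 1) = (∑ j ∈ Finset.Icc 1 (m - 1), 2 * W (t + j)) + W t) :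
    ∃ a : ℂ → ℂ, ∀ t, (W t : ℂ) = ∑ z ∈ (heckePoly ℂ m).roots.toFinset, a z * z ^ t := by
  classical
  set s := (heckePoly ℂ m).roots.toFinset with hs
  have h0 : heckePoly ℂ m ≠ 0 := (monic_and_natDegree_heckePoly hm).1.ne_zero
  have hcard : s.card = m + 1 := by
    rw [hs, Multiset.toFinset_card_of_nodup (nodup_roots_heckePoly hm),
      IsAlgClosed.card_roots_eq_natDegree, (monic_and_natDegree_heckePoly hm).2]
  let e : Fin (m + 1) ≃ s := (s.equivFinOfCardEq hcard).symm
  let v : Fin (m + 1) → ℂ := fun i => e i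
  have hv : Function.Injective v := Subtype.val_injective.comp e.injective
  have hdet : IsUnit (Matrix.vandermonde v).det :=
    (Matrix.det_vandermonde_ne_zero_iff.mpr hv).isUnit
  let c : Fin (m + 1) → ℂ :=
    
    
    Matrix.vecMul (fun j : Fin (m + 1) => (W j : ℂ)) (Matrix.vandermonde v)⁻¹
  have hc : Matrix.vecMul c (Matrix.vandermonde v) = fun j : Fin (m + 1) => (W j : ℂ) := by
    simp only [c]
    rw [Matrix.vecMul_vecMul, Matrix.nonsing_inv_mul _ hdet, Matrix.vecMul_one]
  let a : ℂ → ℂ := fun z => if hz : z ∈ s then c (e.symm ⟨z, hz⟩) else 0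
  have hsum : ∀ t, ∑ z ∈ s, a z * z ^ t = ∑ i, c i * v i ^ t := by
    intro t
    rw [← Finset.sum_coe_sort, ← e.sum_comp]
    simp [a, v]
  refine ⟨a, fun t => ?_⟩
  induction t using Nat.strong_induction_on with
  | _ t ih =>
    by_cases ht : t < m + 1
    · have := congrFun hc ⟨t, ht⟩
      rw [hsum, ← this]
      rfl
    · obtain ⟨n, rfl⟩ : ∃ n, t = n + m + 1 := ⟨t - (m + 1), by omega⟩
      rw [hW]
      push_cast
      rw [ih n (by omega), Finset.sum_congr rfl (fun j hj => by
        rw [ih (n + j) (by have := (Finset.mem_Icc.mp hj).2; omega), Finset.mul_sum]),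
        Finset.sum_comm, ← Finset.sum_add_distrib]
      refine Finset.sum_congr rfl fun z hz => ?_
      have hr : z ^ (m + 1) = _ :=
        isRoot_heckePoly_iff.mp (isRoot_of_mem_roots (Multiset.mem_toFinset.mp hz))
      rw [add_assoc n, pow_add z n, hr, mul_add, mul_add, Finset.mul_sum, Finset.mul_sum]
      congr 1
      · refine Finset.sum_congr rfl fun j _ => ?_
        rw [pow_add]; ring
      · ring

theorem root_mem_toFinset {m : ℕ} (hm : 2 ≤ m) {β : ℝ} (h : (heckePoly ℝ m).IsRoot β) :
    (β : ℂ) ∈ (heckePoly ℂ m).roots.toFinset := by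
  rw [Multiset.mem_toFinset, mem_roots (monic_and_natDegree_heckePoly hm).1.ne_zero,
    isRoot_heckePoly_iff]
  exact_mod_cast isRoot_heckePoly_iff.mp h

theorem tendsto_div_pow_of_eq_sum {m : ℕ} (hm : 2 ≤ m) {β : ℝ} (hβ : 0 < β)
    (h : (heckePoly ℝ m).IsRoot β) {N : ℕ → ℝ} {t₀ : ℕ} {a : ℂ → ℂ}
    (ha : ∀ t, t₀ ≤ t → (N t : ℂ) = ∑ z ∈ (heckePoly ℂ m).roots.toFinset, a z * z ^ t) :
    Tendsto (fun t => ((N t / β ^ t : ℝ) : ℂ)) atTop (𝓝 (a β)) := by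
  classical
  have hβ0 : (β : ℂ) ≠ 0 := by exact_mod_cast hβ.ne'
  have h1 : Tendsto (fun t : ℕ => ∑ z ∈ (heckePoly ℂ m).roots.toFinset, a z * (z / β) ^ t) atTop
      (𝓝 (∑ z ∈ (heckePoly ℂ m).roots.toFinset, if z = β then a z else 0)) := by
    refine tendsto_finsetSum _ fun z hz => ?_
    split_ifs with hzβ
    · subst hzβ
      simp [hβ0]
    · have hlt := norm_lt_of_isRoot hm hβ h
        (isRoot_of_mem_roots (Multiset.mem_toFinset.mp hz)) hzβ
      have : ‖z / (β : ℂ)‖ < 1 := by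
        rw [norm_div, Complex.norm_real, Real.norm_of_nonneg hβ.le, div_lt_one hβ]
        exact hlt
      simpa using (tendsto_pow_atTop_nhds_zero_of_norm_lt_one this).const_mul (a z)
  rw [Finset.sum_ite_eq' _ _ _, if_pos (root_mem_toFinset hm h)] at h1
  refine h1.congr' ?_
  filter_upwards [eventually_ge_atTop t₀] with t ht
  push_cast
  rw [ha t ht, Finset.sum_div]
  exact Finset.sum_congr rfl fun z _ => by rw [div_pow, mul_div_assoc]

/-- The coefficient of `β ^ t` is the limit of `N t / β ^ t`; in particular it is unique. -/
theorem IsCoefficient.tendsto {m : ℕ} (hm : 2 ≤ m) {β : ℝ} (hβ : 0 < β)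
    (h : (heckePoly ℝ m).IsRoot β) {N : ℕ → ℝ} {t₀ : ℕ} {c : ℝ} (hc : IsCoefficient m N t₀ β c) :
    Tendsto (fun t => N t / β ^ t) atTop (𝓝 c) := by
  obtain ⟨a, hac, ha⟩ := hc
  have := tendsto_div_pow_of_eq_sum hm hβ h ha
  rw [hac] at this
  exact_mod_cast (Complex.continuous_re.tendsto _).comp this

theorem existsUnique_isCoefficient {m : ℕ} (hm : 2 ≤ m) {β : ℝ} (hβ : 0 < β)
    (h : (heckePoly ℝ m).IsRoot β) {N : ℕ → ℝ} {t₀ : ℕ} {a : ℂ → ℂ}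
    (ha : ∀ t, t₀ ≤ t → (N t : ℂ) = ∑ z ∈ (heckePoly ℂ m).roots.toFinset, a z * z ^ t) :
    ∃! c : ℝ, IsCoefficient m N t₀ β c := by
  have h1 := tendsto_div_pow_of_eq_sum hm hβ h ha
  -- the leading coefficient is real, being a limit of real numbers
  have him : (a β).im = 0 := by
    have h2 := (Complex.continuous_im.tendsto _).comp h1
    refine tendsto_nhds_unique h2 ?_
    simp only [Function.comp_def, Complex.ofReal_im]
    exact tendsto_const_nhds
  refine ⟨(a β).re, ⟨a, Complex.ext (by simp) (by simp [him]), ha⟩, fun c hc => ?_⟩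
  have h3 := hc.tendsto hm hβ h
  have h2 := (Complex.continuous_re.tendsto _).comp h1
  exact tendsto_nhds_unique h3 (by simpa only [Function.comp_def, Complex.ofReal_re] using h2)

theorem ne_zero_of_mem_roots {m : ℕ} (hm : 2 ≤ m) {z : ℂ}
    (hz : z ∈ (heckePoly ℂ m).roots.toFinset) : z ≠ 0 := by
  rintro rfl
  rcases root_dichotomy hm (isRoot_of_mem_roots (Multiset.mem_toFinset.mp hz)) with h | h
  · simp at h
  · rw [zero_pow (by omega)] at h; simp at h

/-- A solution of the recurrence which is positive from some point on grows at least as fast as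
`β ^ t`. -/
theorem exists_pos_mul_pow_le {m : ℕ} {β : ℝ} (hβ : 0 < β)
    (h : (heckePoly ℝ m).IsRoot β) {W : ℕ → ℝ}
    (hW : ∀ t, W (t + m + 1) = (∑ j ∈ Finset.Icc 1 (m - 1), 2 * W (t + j)) + W t) {t₀ : ℕ}
    (hpos : ∀ t, t₀ ≤ t → 0 < W t) : ∃ c : ℝ, 0 < c ∧ ∀ t, t₀ ≤ t → c * β ^ t ≤ W t := by
  obtain ⟨i, hi, hmin⟩ := Finset.exists_min_image (Finset.Icc t₀ (t₀ + m)) (fun t => W t / β ^ t)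
    ⟨t₀, by simp⟩
  refine ⟨W i / β ^ i, div_pos (hpos i (Finset.mem_Icc.mp hi).1) (pow_pos hβ i), fun t => ?_⟩
  induction t using Nat.strong_induction_on with
  | _ t ih =>
    intro ht
    by_cases ht' : t ≤ t₀ + m
    · exact (le_div_iff₀ (pow_pos hβ t)).mp (hmin t (Finset.mem_Icc.mpr ⟨ht, ht'⟩))
    · obtain ⟨n, rfl⟩ : ∃ n, t = n + m + 1 := ⟨t - (m + 1), by omega⟩
      rw [hW, add_assoc n, pow_add β n, isRoot_heckePoly_iff.mp h, mul_add, mul_add, mul_one,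
        Finset.mul_sum, Finset.mul_sum]
      refine add_le_add (Finset.sum_le_sum fun j hj => ?_) (ih n (by omega) (by omega))
      have hj' := (Finset.mem_Icc.mp hj).2
      calc W i / β ^ i * (β ^ n * (2 * β ^ j)) = 2 * (W i / β ^ i * β ^ (n + j)) := by
            rw [pow_add]; ring
        _ ≤ 2 * W (n + j) := by linarith [ih (n + j) (by omega) (by omega)]

/-! ### Words and normal forms -/

/-- The product of the syllables `a * b ^ x`, for the exponents `x` in the list. -/
def wordProd {G : Type*} [Group G] (a b : G) {k : ℕ} (l : List (ZMod k)) : G :=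
  (l.map fun x => a * b ^ x.val).prod

section wordProd

variable {G : Type*} [Group G] {a b : G} {k : ℕ}

@[simp] theorem wordProd_nil : wordProd a b ([] : List (ZMod k)) = 1 := rfl

@[simp] theorem wordProd_cons (x : ZMod k) (l : List (ZMod k)) :
    wordProd a b (x :: l) = a * b ^ x.val * wordProd a b l := by
  simp [wordProd]

@[simp] theorem wordProd_append (l l' : List (ZMod k)) :
    wordProd a b (l ++ l') = wordProd a b l * wordProd a b l' := by
  simp [wordProd]

theorem map_wordProd {H : Type*} [Group H] (f : G →* H) (l : List (ZMod k)) :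
    f (wordProd a b l) = wordProd (f a) (f b) l := by
  induction l with
  | nil => simp
  | cons x l ih => simp [ih]

theorem pow_val_natCast [NeZero k] (hb : b ^ k = 1) (n : ℕ) : b ^ (n : ZMod k).val = b ^ n := by
  rw [ZMod.val_natCast, ← pow_eq_pow_mod _ hb]

theorem pow_val_add [NeZero k] (hb : b ^ k = 1) (x y : ZMod k) :
    b ^ (x + y).val = b ^ x.val * b ^ y.val := by
  rw [ZMod.val_add, ← pow_eq_pow_mod _ hb, pow_add]

theorem pow_val_neg [NeZero k] (hb : b ^ k = 1) (x : ZMod k) :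
    b ^ (-x).val = (b ^ x.val)⁻¹ := by
  rw [eq_inv_iff_mul_eq_one, ← pow_val_add hb]
  simp

/-- In a group generated by `a` and `b` with `a ^ 2 = b ^ k = 1`, every element is an alternating
product of `a` and nontrivial powers of `b`. -/
theorem exists_normalForm [NeZero k] (ha : a * a = 1) (hb : b ^ k = 1) {g : G}
    (hg : g ∈ Subgroup.closure {a, b}) :
    ∃ (s t : G) (l : List (ZMod k)), (s = 1 ∨ s = a) ∧ (t = 1 ∨ t = a) ∧ (∀ x ∈ l, x ≠ 0) ∧
      g = s * wordProd a b l * t := by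
  have stepA : ∀ g, (∃ (s t : G) (l : List (ZMod k)), (s = 1 ∨ s = a) ∧ (t = 1 ∨ t = a) ∧
      (∀ x ∈ l, x ≠ 0) ∧ g = s * wordProd a b l * t) →
      ∃ (s t : G) (l : List (ZMod k)), (s = 1 ∨ s = a) ∧ (t = 1 ∨ t = a) ∧
      (∀ x ∈ l, x ≠ 0) ∧ a * g = s * wordProd a b l * t := by
    rintro g ⟨s, t, l, rfl | rfl, ht, hl, rfl⟩
    · exact ⟨a, t, l, .inr rfl, ht, hl, by group⟩
    · exact ⟨1, t, l, .inl rfl, ht, hl, by rw [← mul_assoc, ← mul_assoc, ha]⟩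
  have stepB : ∀ (n : ℕ) g, (∃ (s t : G) (l : List (ZMod k)), (s = 1 ∨ s = a) ∧
      (t = 1 ∨ t = a) ∧ (∀ x ∈ l, x ≠ 0) ∧ g = s * wordProd a b l * t) →
      ∃ (s t : G) (l : List (ZMod k)), (s = 1 ∨ s = a) ∧ (t = 1 ∨ t = a) ∧
      (∀ x ∈ l, x ≠ 0) ∧ b ^ n * g = s * wordProd a b l * t := by
    rintro n g ⟨s, t, l, hs, ht, hl, rfl⟩
    by_cases hn : (n : ZMod k) = 0
    · refine ⟨s, t, l, hs, ht, hl, ?_⟩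
      rw [← pow_val_natCast (k := k) hb n, hn]
      simp
    have e : ∀ h : G, b ^ n * h = a * (a * b ^ (n : ZMod k).val * h) := fun h => by
      rw [pow_val_natCast hb, mul_assoc, ← mul_assoc a a, ha, one_mul]
    rcases hs with rfl | rfl
    · refine ⟨a, t, (n : ZMod k) :: l, .inr rfl, ht, ?_, ?_⟩
      · simpa [hn] using hl
      · rw [e, wordProd_cons]; group
    · cases l with
      | nil =>
        refine ⟨s, s * t, [(n : ZMod k)], .inr rfl, ?_, by simpa using hn, ?_⟩
        · rcases ht with rfl | rfl
          · right; simp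
          · left; exact ha
        · rw [e]; simp [mul_assoc]
      | cons x l =>
        simp only [List.mem_cons, forall_eq_or_imp] at hl
        have e2 : b ^ n * (s * wordProd s b (x :: l) * t)
            = s * (s * b ^ ((n : ZMod k) + x).val) * wordProd s b l * t := by
          rw [pow_val_add hb, pow_val_natCast hb, wordProd_cons, ← mul_assoc s s, ha]
          simp only [← mul_assoc]
          rw [mul_assoc (b ^ n) s s, ha]
          group
        by_cases hx : (n : ZMod k) + x = 0
        · refine ⟨1, t, l, .inl rfl, ht, hl.2, ?_⟩
          rw [e2, hx]
          simp [ha]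
        · refine ⟨s, t, ((n : ZMod k) + x) :: l, .inr rfl, ht, by simpa [hx] using hl.2, ?_⟩
          rw [e2, wordProd_cons]
          group
  induction hg using Subgroup.closure_induction_left with
  | one => exact ⟨1, 1, [], .inl rfl, .inl rfl, by simp, by simp⟩
  | mul_left x hx y hy ih =>
    rcases hx with rfl | rfl
    · exact stepA _ ih
    · simpa using stepB 1 _ ih
  | inv_mul_cancel x hx y hy ih =>
    rcases hx with rfl | rfl
    · rw [inv_eq_of_mul_eq_one_right ha]
      exact stepA _ ih
    · have : x⁻¹ = x ^ (k - 1) := by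
        rw [inv_eq_iff_mul_eq_one, ← pow_succ', Nat.sub_add_cancel (NeZero.one_le), hb]
      rw [this]
      exact stepB _ _ ih

end wordProd

/-! ### The action on horocyclic states -/

/-- A tape with a head: the entries below the head vanish, those above it do not. It encodes the
infinite reduced word `B ^ s(d) A B ^ s(d+1) A B ^ s(d+2) ⋯` (`s` the tape, `d` the head),
together with the integer `d`, which makes shifted words comparable. -/
@[ext] structure State (k : ℕ) where
  /-- The exponents. -/
  tape : ℤ → ZMod k
  /-- The position of the first exponent, which alone may vanish. -/
  head : ℤ
  tape_of_lt : ∀ i < head, tape i = 0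
  tape_of_gt : ∀ i, head < i → tape i ≠ 0

namespace State

variable {k : ℕ}

/-- The action of the generator of order two, which only moves the head. -/
def move (p : State k) : State k :=
  if h : p.tape p.head = 0 then
    ⟨p.tape, p.head + 1, fun i hi => by
      rcases (Int.lt_add_one_iff.mp hi).lt_or_eq with hi | rfl
      · exact p.tape_of_lt i hi
      · exact h, fun i hi => p.tape_of_gt i (by omega)⟩
  else
    ⟨p.tape, p.head - 1, fun i hi => p.tape_of_lt i (by omega), fun i hi => by
      rcases (Int.sub_one_lt_iff.mp hi).lt_or_eq with hi | rfl
      · exact p.tape_of_gt i hi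
      · exact h⟩

/-- The action of a power of the generator of order `k`, which changes the tape at the head. -/
def turn (y : ZMod k) (p : State k) : State k :=
  ⟨Function.update p.tape p.head (p.tape p.head + y), p.head,
    fun i hi => by rw [Function.update_of_ne hi.ne]; exact p.tape_of_lt i hi,
    fun i hi => by rw [Function.update_of_ne hi.ne']; exact p.tape_of_gt i hi⟩

/-- Shifting tape and head. -/
def translate (n : ℤ) (p : State k) : State k :=
  ⟨fun i => p.tape (i + n), p.head - n, fun i hi => p.tape_of_lt _ (by omega),
    fun i hi => p.tape_of_gt _ (by omega)⟩

@[simp] theorem tape_move (p : State k) : p.move.tape = p.tape := by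
  unfold move; split_ifs <;> rfl

theorem head_move (p : State k) :
    p.move.head = if p.tape p.head = 0 then p.head + 1 else p.head - 1 := by
  unfold move; split_ifs <;> rfl

@[simp] theorem head_turn (y : ZMod k) (p : State k) : (p.turn y).head = p.head := rfl

theorem tape_turn (y : ZMod k) (p : State k) :
    (p.turn y).tape = Function.update p.tape p.head (p.tape p.head + y) := rfl

@[simp] theorem head_translate (n : ℤ) (p : State k) : (p.translate n).head = p.head - n := rfl

@[simp] theorem tape_translate (n : ℤ) (p : State k) (i : ℤ) :
    (p.translate n).tape i = p.tape (i + n) := rfl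

theorem move_move (p : State k) : p.move.move = p := by
  ext1
  · simp
  · rw [head_move p.move, tape_move, head_move]
    split_ifs with h1 h2 h2
    · exact absurd h2 (p.tape_of_gt _ (by omega))
    · omega
    · omega
    · exact absurd (p.tape_of_lt _ (by omega)) h2

theorem turn_turn (x y : ZMod k) (p : State k) : (p.turn x).turn y = p.turn (x + y) := by
  ext1
  · simp [tape_turn, add_assoc]
  · rfl

theorem turn_zero (p : State k) : p.turn 0 = p := by
  ext1
  · simp [tape_turn]
  · rfl

theorem move_translate (n : ℤ) (p : State k) : (p.translate n).move = p.move.translate n := by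
  ext1
  · funext i; simp
  · simp only [head_move, head_translate, tape_translate, sub_add_cancel]
    split_ifs <;> ring

theorem turn_translate (n : ℤ) (y : ZMod k) (p : State k) :
    (p.translate n).turn y = (p.turn y).translate n := by
  ext1
  · funext i
    simp only [tape_turn, tape_translate, head_translate, sub_add_cancel, Function.update_apply]
    simp [eq_sub_iff_add_eq]
  · rfl

/-- `State.move` as a permutation. -/
def permA (k : ℕ) : Equiv.Perm (State k) := ⟨move, move, move_move, move_move⟩

/-- `State.turn` as a permutation. -/
def permB (y : ZMod k) : Equiv.Perm (State k) :=
  ⟨turn y, turn (-y), fun p => by rw [turn_turn, add_neg_cancel, turn_zero],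
    fun p => by rw [turn_turn, neg_add_cancel, turn_zero]⟩

@[simp] theorem permA_apply (p : State k) : permA k p = p.move := rfl

@[simp] theorem permB_apply (y : ZMod k) (p : State k) : permB y p = p.turn y := rfl

theorem permA_mul_self : permA k * permA k = 1 := Equiv.ext move_move

theorem permB_one_pow (n : ℕ) : (permB (1 : ZMod k)) ^ n = permB (n : ZMod k) := by
  induction n with
  | zero => ext1 p; simp [turn_zero]
  | succ n ih => ext1 p; simp [pow_succ', ih, turn_turn]

theorem permB_one_pow_self : (permB (1 : ZMod k)) ^ k = 1 := by
  rw [permB_one_pow]; ext1 p; simp [turn_zero]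

theorem permB_one_pow_val [NeZero k] (x : ZMod k) : (permB (1 : ZMod k)) ^ x.val = permB x := by
  rw [permB_one_pow, ZMod.natCast_zmod_val]

end State

/-- The bi-infinite periodic extension of a list of exponents. -/
def periodic {k : ℕ} (I : List (ZMod k)) (i : ℤ) : ZMod k := I.getD (i % I.length).toNat 0

section periodic

variable {k : ℕ}

theorem periodic_add_mul (I : List (ZMod k)) (i c : ℤ) :
    periodic I (i + I.length * c) = periodic I i := by
  simp [periodic]

theorem periodic_add_length (I : List (ZMod k)) (i : ℤ) :
    periodic I (i + I.length) = periodic I i := by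
  simpa using periodic_add_mul I i 1

theorem periodic_natCast {I : List (ZMod k)} {i : ℕ} (hi : i < I.length) :
    periodic I i = I.getD i 0 := by
  rw [periodic, Int.emod_eq_of_lt (by omega) (by omega), Int.toNat_natCast]

theorem periodic_mem {I : List (ZMod k)} (hI : I ≠ []) (i : ℤ) : periodic I i ∈ I := by
  have hpos : (0 : ℤ) < I.length := by exact_mod_cast List.length_pos_iff.mpr hI
  have h1 := Int.emod_nonneg i hpos.ne'
  have h2 := Int.emod_lt_of_pos i hpos
  rw [periodic, List.getD_eq_getElem _ _ (by omega)]
  exact List.getElem_mem _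

/-- The state whose tape above the head `0` is the periodic extension of `I`. -/
def periodicState (I : List (ZMod k)) (hI : I ≠ []) (h0 : ∀ x ∈ I, x ≠ 0) : State k :=
  ⟨fun i => if i ≤ 0 then 0 else periodic I (i - 1), 0, fun i hi => if_pos hi.le,
    fun i hi => by rw [if_neg (by omega)]; exact h0 _ (periodic_mem hI _)⟩

end periodic

/-! ### Dynamics of the action and conjugacy of words -/

section dynamics

variable {G : Type*} [Group G] {a b : G} {k : ℕ}
  (ψ : G →* Equiv.Perm (State k))

theorem act_translate (ha : ψ a = State.permA k) (hb : ψ b = State.permB 1)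
    (hG : Subgroup.closure {a, b} = ⊤) (g : G) (n : ℤ) (p : State k) :
    ψ g (p.translate n) = (ψ g p).translate n := by
  have hg : g ∈ Subgroup.closure {a, b} := hG ▸ Subgroup.mem_top g
  induction hg using Subgroup.closure_induction generalizing p with
  | mem x hx =>
    rcases hx with rfl | rfl
    · rw [ha]; exact p.move_translate n
    · rw [hb]; exact p.turn_translate n 1
  | one => simp
  | mul x y _ _ hx hy => simp [hx, hy]
  | inv x _ hx =>
    rw [map_inv, Equiv.Perm.inv_eq_iff_eq, hx]
    simp

/-- A group element changes only finitely much of the tape. -/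
theorem act_tape_eventually (ha : ψ a = State.permA k) (hb : ψ b = State.permB 1)
    (hG : Subgroup.closure {a, b} = ⊤) (g : G) (p : State k) :
    ∃ M : ℤ, ∀ i, M < i → (ψ g p).tape i = p.tape i := by
  have hg : g ∈ Subgroup.closure {a, b} := hG ▸ Subgroup.mem_top g
  induction hg using Subgroup.closure_induction generalizing p with
  | mem x hx =>
    rcases hx with rfl | rfl
    · exact ⟨0, fun i _ => by rw [ha]; simp⟩
    · refine ⟨p.head, fun i hi => ?_⟩
      rw [hb, State.permB_apply, State.tape_turn, Function.update_of_ne hi.ne']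
  | one => exact ⟨0, by simp⟩
  | mul x y _ _ hx hy =>
    obtain ⟨M, hM⟩ := hy p
    obtain ⟨M', hM'⟩ := hx (ψ y p)
    refine ⟨max M M', fun i hi => ?_⟩
    rw [map_mul, Equiv.Perm.mul_apply, hM' i (by omega), hM i (by omega)]
  | inv x _ hx =>
    obtain ⟨M, hM⟩ := hx ((ψ x)⁻¹ p)
    refine ⟨M, fun i hi => ?_⟩
    rw [map_inv, ← hM i hi]
    simp

/-- A reduced word writes its exponents below a vanishing entry at the head. -/
theorem act_wordProd [NeZero k] (ha : ψ a = State.permA k) (hb : ψ b = State.permB 1)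
    {l : List (ZMod k)} (hl : ∀ x ∈ l, x ≠ 0) {p : State k} (hp : p.tape p.head = 0) :
    (ψ (wordProd a b l) p).head = p.head - l.length ∧
    (ψ (wordProd a b l) p).tape (p.head - l.length) = 0 ∧
    (∀ i : ℕ, i < l.length →
      (ψ (wordProd a b l) p).tape (p.head - l.length + 1 + i) = l.getD i 0) ∧
    ∀ i, p.head < i → (ψ (wordProd a b l) p).tape i = p.tape i := by
  induction l with
  | nil => simpa using hp
  | cons x l ih =>
    simp only [List.mem_cons, forall_eq_or_imp] at hl
    obtain ⟨h1, h2, h3, h4⟩ := ih hl.2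
    set q := ψ (wordProd a b l) p with hq
    have e : ψ (wordProd a b (x :: l)) p = (q.turn x).move := by
      rw [wordProd_cons, map_mul, map_mul, map_pow, ha, hb, State.permB_one_pow_val]
      rfl
    have hx : (q.turn x).tape q.head = x := by
      rw [State.tape_turn, Function.update_self, h1, h2, zero_add]
    have hne : ∀ i, i ≠ q.head → (q.turn x).tape i = q.tape i := fun i hi => by
      rw [State.tape_turn, Function.update_of_ne hi]
    rw [e]
    simp only [State.tape_move, List.length_cons, Nat.cast_add, Nat.cast_one]
    refine ⟨?_, ?_, ?_, ?_⟩
    · rw [State.head_move, State.head_turn, hx, if_neg hl.1]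
      omega
    · rw [hne _ (by omega)]
      exact q.tape_of_lt _ (by omega)
    · intro i hi
      cases i with
      | zero =>
        have : p.head - (l.length + 1 : ℤ) + 1 + (0 : ℕ) = q.head := by push_cast; omega
        rw [this, hx]; simp
      | succ i =>
        rw [hne _ (by push_cast; omega), List.getD_cons_succ, ← h3 i (by omega)]
        congr 1
        push_cast
        ring
    · intro i hi
      rw [hne _ (by omega), h4 i hi]

/-- If the entry at the head does not vanish, then it is the inverse of a reduced word that lowers
the head by the length of the word. -/
theorem head_act_wordProd_inv [NeZero k] (ha : ψ a = State.permA k) (hb : ψ b = State.permB 1)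
    {l : List (ZMod k)} (hl : ∀ x ∈ l, x ≠ 0) {p : State k} (hp : p.tape p.head ≠ 0) :
    (ψ (wordProd a b l)⁻¹ p).head = p.head - l.length ∧
    (ψ (wordProd a b l)⁻¹ p).tape (p.head - l.length) ≠ 0 := by
  induction l generalizing p with
  | nil => simpa using hp
  | cons x l ih =>
    simp only [List.mem_cons, forall_eq_or_imp] at hl
    have e : ψ (wordProd a b (x :: l))⁻¹ p = ψ (wordProd a b l)⁻¹ (p.move.turn (-x)) := by
      rw [wordProd_cons, mul_inv_rev, mul_inv_rev, map_mul, map_mul, map_inv ψ (b ^ _), map_pow,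
        map_inv ψ a, ha, hb, State.permB_one_pow_val]
      rfl
    have hh : (p.move.turn (-x)).head = p.head - 1 := by
      rw [State.head_turn, State.head_move, if_neg hp]
    have ht : (p.move.turn (-x)).tape (p.move.turn (-x)).head ≠ 0 := by
      have h0 : p.move.head = p.head - 1 := hh
      rw [State.head_turn, State.tape_turn, Function.update_self, State.tape_move, h0,
        p.tape_of_lt _ (by omega), zero_add]
      exact neg_ne_zero.mpr hl.1
    have := ih hl.2 ht
    rw [hh] at this
    rw [e]
    have e2 : p.head - ((x :: l).length : ℤ) = p.head - 1 - l.length := by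
      rw [List.length_cons]; push_cast; ring
    rw [e2]
    exact this

/-- A word translates its periodic state by its length. -/
theorem act_periodicState [NeZero k] (ha : ψ a = State.permA k) (hb : ψ b = State.permB 1)
    {I : List (ZMod k)} (hI : I ≠ []) (h0 : ∀ x ∈ I, x ≠ 0) :
    ψ (wordProd a b I) (periodicState I hI h0) = (periodicState I hI h0).translate I.length := by
  obtain ⟨h1, h2, h3, h4⟩ := act_wordProd ψ ha hb h0 (p := periodicState I hI h0) (by
    simp [periodicState])
  set q := ψ (wordProd a b I) (periodicState I hI h0)
  have hz : (periodicState I hI h0).head = 0 := rfl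
  rw [hz] at h1 h2 h3 h4
  ext1
  · funext i
    rw [State.tape_translate]
    simp only [periodicState] at h4 ⊢
    split_ifs with hi
    · rcases (show i ≤ 0 - (I.length : ℤ) by omega).lt_or_eq with hi' | rfl
      · exact q.tape_of_lt _ (by omega)
      · exact h2
    · by_cases hi0 : 0 < i
      · rw [h4 i hi0, if_neg (by omega), ← periodic_add_length I]
        congr 1; ring
      · obtain ⟨j, hj⟩ : ∃ j : ℕ, (j : ℤ) = i + I.length - 1 := ⟨(i + I.length - 1).toNat, by omega⟩
        rw [← hj, periodic_natCast (by omega), ← h3 j (by omega)]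
        congr 1; omega
  · exact h1

/-- Conjugate reduced words are cyclic rotations of each other. -/
theorem periodic_eq_of_isConj [NeZero k] (ha : ψ a = State.permA k) (hb : ψ b = State.permB 1)
    (hG : Subgroup.closure {a, b} = ⊤)
    {I J : List (ZMod k)} (hI : I ≠ []) (hI0 : ∀ x ∈ I, x ≠ 0) (hJ0 : ∀ x ∈ J, x ≠ 0)
    (h : IsConj (wordProd a b I) (wordProd a b J)) :
    I.length = J.length ∧ ∃ d : ℤ, ∀ i, periodic J i = periodic I (i + d) := by
  obtain ⟨g, hg⟩ := isConj_iff.mp h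
  set P := periodicState I hI hI0 with hP
  set p := ψ g P with hp
  have hn : 0 < I.length := List.length_pos_iff.mpr hI
  have hfix : ψ (wordProd a b J) p = p.translate I.length := by
    rw [hp, ← Equiv.Perm.mul_apply, ← map_mul, ← hg, inv_mul_cancel_right, map_mul,
      Equiv.Perm.mul_apply, act_periodicState ψ ha hb, act_translate ψ ha hb hG]
  by_cases h0 : p.tape p.head = 0
  · obtain ⟨h1, h2, h3, h4⟩ := act_wordProd ψ ha hb hJ0 h0
    rw [hfix] at h1 h2 h3 h4
    simp only [State.head_translate, State.tape_translate] at h1 h2 h3 h4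
    have hlen : I.length = J.length := by omega
    refine ⟨hlen, ?_⟩
    have key : ∀ i : ℕ, p.tape (p.head + 1 + i) = periodic J i := by
      intro i
      induction i using Nat.strong_induction_on with
      | _ i ih =>
        by_cases hi : i < J.length
        · rw [periodic_natCast hi, ← h3 i hi]
          congr 1; omega
        · obtain ⟨j, rfl⟩ : ∃ j, i = j + J.length := ⟨i - J.length, by omega⟩
          have := h4 (p.head + 1 + j) (by omega)
          rw [ih j (by omega)] at this
          push_cast
          rw [periodic_add_length, ← this, hlen]
          congr 1; omega
    obtain ⟨M, hM⟩ := act_tape_eventually ψ ha hb hG g P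
    refine ⟨p.head, fun i => ?_⟩
    -- compare far to the right, where the tapes of `p` and `P` agree
    obtain ⟨c, hc1, hc2, hc3⟩ : ∃ c : ℤ, 0 ≤ i + J.length * c ∧
        M < p.head + 1 + (i + J.length * c) ∧ 0 < p.head + 1 + (i + J.length * c) := by
      refine ⟨|i| + |M| + |p.head| + 1, ?_⟩
      have hJ1 : (1 : ℤ) ≤ J.length := by omega
      have h5 : |i| + |M| + |p.head| + 1 ≤ J.length * (|i| + |M| + |p.head| + 1) := by
        nlinarith [abs_nonneg i, abs_nonneg M, abs_nonneg p.head]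
      have := neg_abs_le i
      have := le_abs_self M
      have := neg_abs_le p.head
      have := abs_nonneg i
      have := abs_nonneg M
      have := abs_nonneg p.head
      refine ⟨?_, ?_, ?_⟩ <;> linarith
    obtain ⟨j, hj⟩ : ∃ j : ℕ, (j : ℤ) = i + J.length * c := ⟨(i + J.length * c).toNat, by omega⟩
    have h6 := key j
    rw [hj, periodic_add_mul] at h6
    rw [← h6, hM _ hc2, hP]
    simp only [periodicState]
    rw [if_neg (by omega), ← periodic_add_mul I (i + p.head) c, hlen]
    congr 1; ring
  · obtain ⟨h1, -⟩ := head_act_wordProd_inv ψ ha hb hJ0 h0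
    have h2 := act_translate ψ ha hb hG (wordProd a b J)⁻¹ I.length p
    rw [← hfix, ← Equiv.Perm.mul_apply, ← map_mul, inv_mul_cancel, map_one,
      Equiv.Perm.one_apply] at h2
    have h3 := congrArg State.head h2
    rw [State.head_translate, h1] at h3
    omega

theorem wordProd_ne_one [NeZero k] (ha : ψ a = State.permA k) (hb : ψ b = State.permB 1)
    {I : List (ZMod k)} (hI : I ≠ []) (h0 : ∀ x ∈ I, x ≠ 0) : wordProd a b I ≠ 1 := by
  intro h
  have h1 := congrArg State.head (act_periodicState ψ ha hb hI h0)
  have hn : 0 < I.length := List.length_pos_iff.mpr hI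
  rw [h, State.head_translate, map_one, Equiv.Perm.one_apply] at h1
  omega

/-- The length of the shortest power of the generator with exponent `x`. -/
def syllable (x : ZMod k) : ℕ := x.valMinAbs.natAbs

/-- The number of letters of a reduced word. -/
def weight (l : List (ZMod k)) : ℕ := (l.map fun x => syllable x + 1).sum

theorem syllable_add_le (x y : ZMod k) : syllable (x + y) ≤ syllable x + syllable y :=
  (ZMod.natAbs_valMinAbs_add_le x y).trans (Int.natAbs_add_le _ _)

theorem syllable_neg (x : ZMod k) : syllable (-x) = syllable x := ZMod.natAbs_valMinAbs_neg x

theorem syllable_one_le [NeZero k] : syllable (1 : ZMod k) ≤ 1 := by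
  rw [syllable, ZMod.valMinAbs_natAbs_eq_min]
  refine (min_le_left _ _).trans ?_
  have := ZMod.val_natCast k 1
  rw [Nat.cast_one] at this
  rw [this]
  exact Nat.mod_le _ _

/-- The potential of a state: the letters written on a window of the tape, minus the head. -/
def potential (c : ℤ) (N : ℕ) (p : State k) : ℤ :=
  (∑ i ∈ Finset.range N, syllable (p.tape (c + i)) : ℕ) - p.head

theorem potential_turn_le (c : ℤ) (N : ℕ) (p : State k) {y : ZMod k} (hy : syllable y ≤ 1) :
    potential c N (p.turn y) ≤ potential c N p + 1 := by
  have h1 : ∀ i : ℕ, syllable ((p.turn y).tape (c + i))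
      ≤ syllable (p.tape (c + i)) + if i = (p.head - c).toNat then 1 else 0 := by
    intro i
    rw [State.tape_turn]
    by_cases hi : c + i = p.head
    · rw [hi, Function.update_self, if_pos (by omega)]
      exact (syllable_add_le _ _).trans (by omega)
    · rw [Function.update_of_ne hi]
      omega
  have h2 := Finset.sum_le_sum fun i (_ : i ∈ Finset.range N) => h1 i
  rw [Finset.sum_add_distrib, Finset.sum_ite_eq'] at h2
  unfold potential
  rw [State.head_turn]
  split_ifs at h2 <;> omega

theorem potential_move_le (c : ℤ) (N : ℕ) (p : State k) :
    potential c N p.move ≤ potential c N p + 1 := by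
  unfold potential
  rw [State.tape_move, State.head_move]
  split_ifs <;> omega

theorem potential_act_le [NeZero k] (ha : ψ a = State.permA k) (hb : ψ b = State.permB 1)
    (c : ℤ) (N : ℕ) (L : List G) (hL : ∀ x ∈ L, x = a ∨ x = b ∨ x = b⁻¹) (p : State k) :
    potential c N (ψ L.prod p) ≤ potential c N p + L.length := by
  induction L with
  | nil => simp
  | cons x L ih =>
    simp only [List.mem_cons, forall_eq_or_imp] at hL
    have h1 := ih hL.2
    rw [List.prod_cons, map_mul, Equiv.Perm.mul_apply, List.length_cons]
    set q := ψ L.prod p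
    have h2 : potential c N (ψ x q) ≤ potential c N q + 1 := by
      rcases hL.1 with rfl | rfl | rfl
      · rw [ha]; exact potential_move_le c N q
      · rw [hb]; exact potential_turn_le c N q syllable_one_le
      · rw [map_inv, hb]
        exact potential_turn_le c N q (by rw [syllable_neg]; exact syllable_one_le)
    push_cast
    linarith

theorem weight_eq (I : List (ZMod k)) :
    weight I = (∑ i ∈ Finset.range I.length, syllable (I.getD i 0)) + I.length := by
  induction I with
  | nil => rfl
  | cons x I ih =>
    rw [List.length_cons, Finset.sum_range_succ']
    simp only [weight, List.map_cons, List.sum_cons, List.getD_cons_succ, List.getD_cons_zero]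
      at ih ⊢
    rw [ih]; ring

/-- A word in the generators representing a conjugate of a reduced word is at least as long:
the conjugate translates a state along a periodic tape, which raises the potential by the weight
of a period, while a letter raises it by at most one. -/
theorem weight_le_length [NeZero k] (ha : ψ a = State.permA k) (hb : ψ b = State.permB 1)
    (hG : Subgroup.closure {a, b} = ⊤)
    {I : List (ZMod k)} (hI : I ≠ []) (h0 : ∀ x ∈ I, x ≠ 0) (L : List G)
    (hL : ∀ x ∈ L, x = a ∨ x = b ∨ x = b⁻¹) (h : IsConj (wordProd a b I) L.prod) :
    weight I ≤ L.length := by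
  obtain ⟨g, hg⟩ := isConj_iff.mp h
  set P := periodicState I hI h0 with hP
  set p := ψ g P with hp
  have hn : 0 < I.length := List.length_pos_iff.mpr hI
  have hfix : ψ L.prod p = p.translate I.length := by
    rw [hp, ← Equiv.Perm.mul_apply, ← map_mul, ← hg, inv_mul_cancel_right, map_mul,
      Equiv.Perm.mul_apply, act_periodicState ψ ha hb, act_translate ψ ha hb hG]
  obtain ⟨M, hM⟩ := act_tape_eventually ψ ha hb hG g P
  -- the window starts below the head and ends at a multiple of the period, far to the right
  obtain ⟨c, N, hc, K, hK, hKM⟩ : ∃ (c : ℤ) (N : ℕ), c + I.length ≤ p.head ∧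
      ∃ K : ℕ, c + N = 1 + I.length * K ∧ M < 1 + I.length * K := by
    refine ⟨min (p.head - I.length) 0,
      (1 + I.length * M.toNat - min (p.head - I.length) 0 : ℤ).toNat, by omega, M.toNat, ?_, ?_⟩
    · have : (0 : ℤ) ≤ I.length * M.toNat := by positivity
      omega
    · have : (M.toNat : ℤ) ≤ I.length * M.toNat :=
        le_mul_of_one_le_left (by positivity) (by omega)
      omega
  have h1 := potential_act_le ψ ha hb c N L hL p
  rw [hfix] at h1
  have hlow : ∑ i ∈ Finset.range I.length, syllable (p.tape (c + i)) = 0 := by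
    refine Finset.sum_eq_zero fun i hi => ?_
    rw [p.tape_of_lt _ (by have := Finset.mem_range.mp hi; omega)]
    simp [syllable]
  have hhigh : ∑ i ∈ Finset.range I.length, syllable (p.tape (c + (N + i : ℕ)))
      = ∑ i ∈ Finset.range I.length, syllable (I.getD i 0) := by
    refine Finset.sum_congr rfl fun i hi => ?_
    have e : c + (N + i : ℕ) = 1 + I.length * K + i := by push_cast; omega
    have : (0 : ℤ) ≤ I.length * K := by positivity
    rw [e, hM _ (by omega), hP]
    simp only [periodicState]
    rw [if_neg (by omega), ← periodic_natCast (Finset.mem_range.mp hi),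
      ← periodic_add_mul I i K]
    congr 2; ring
  have hs1 := Finset.sum_range_add (fun i => syllable (p.tape (c + i))) I.length N
  have hs2 := Finset.sum_range_add (fun i => syllable (p.tape (c + i))) N I.length
  rw [add_comm N, hs1, hlow, hhigh] at hs2
  unfold potential at h1
  rw [weight_eq]
  have e : ∑ i ∈ Finset.range N, syllable ((p.translate I.length).tape (c + i))
      = ∑ i ∈ Finset.range N, syllable (p.tape (c + (I.length + i : ℕ))) :=
    Finset.sum_congr rfl fun i _ => by
      rw [State.tape_translate]; congr 2; push_cast; ring
  rw [e, State.head_translate] at h1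
  omega

end dynamics

/-! ### Matrices up to sign -/

theorem mem_center_iff_entries {M : SL(2, ℝ)} :
    M ∈ Subgroup.center SL(2, ℝ) ↔ M 0 1 = 0 ∧ M 1 0 = 0 ∧ M 0 0 = M 1 1 := by
  rw [Matrix.SpecialLinearGroup.mem_center_iff]
  constructor
  · rintro ⟨r, -, h⟩
    have e : ∀ i j, M i j = (Matrix.scalar (Fin 2) r) i j := fun i j => by rw [h]
    simp [e]
  · rintro ⟨h1, h2, h3⟩
    refine ⟨M 0 0, ?_, ?_⟩
    · have := M.det_coe
      rw [Matrix.det_fin_two, h1, h2, ← h3] at this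
      rw [Fintype.card_fin]; linarith
    · ext i j
      fin_cases i <;> fin_cases j <;> simp [h1, h2, h3]

theorem det_entries (M : SL(2, ℝ)) : M 0 0 * M 1 1 - M 0 1 * M 1 0 = 1 := by
  rw [← Matrix.det_fin_two]; exact M.det_coe

theorem mul_entry (M N : SL(2, ℝ)) (i j : Fin 2) :
    (M * N) i j = M i 0 * N 0 j + M i 1 * N 1 j := by
  rw [Matrix.SpecialLinearGroup.coe_mul, Matrix.mul_apply, Fin.sum_univ_two]

theorem mk_neg_eq (M : SL(2, ℝ)) : (QuotientGroup.mk (-M) : PSL(2, ℝ)) = QuotientGroup.mk M := by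
  rw [QuotientGroup.eq, mem_center_iff_entries]
  simp

theorem eq_or_eq_neg_of_mk_eq {M N : SL(2, ℝ)}
    (h : (QuotientGroup.mk M : PSL(2, ℝ)) = QuotientGroup.mk N) :
    (∀ i j, N i j = M i j) ∨ ∀ i j, N i j = -M i j := by
  rw [QuotientGroup.eq, mem_center_iff_entries] at h
  set C := M⁻¹ * N with hC
  have hN : N = M * C := by rw [hC]; group
  have hdet := det_entries C
  rw [h.1, ← h.2.2] at hdet
  have h1 : (C 0 0 - 1) * (C 0 0 + 1) = 0 := by linarith
  have e : ∀ i j, N i j = M i j * C 0 0 := by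
    intro i j
    rw [hN, mul_entry]
    fin_cases j
    · simp [h.2.1]
    · simp [h.1, h.2.2]
  rcases mul_eq_zero.mp h1 with h1 | h1
  · left; intro i j; rw [e, show C 0 0 = 1 by linarith, mul_one]
  · right; intro i j; rw [e, show C 0 0 = -1 by linarith]; ring

theorem mk_eq_of_entries_neg {M N : SL(2, ℝ)} (h : ∀ i j, N i j = -M i j) :
    (QuotientGroup.mk M : PSL(2, ℝ)) = QuotientGroup.mk N := by
  have : N = -M := by ext i j; simpa using h i j
  rw [this, mk_neg_eq]

/-! ### Involutions of the upper half-plane -/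

/-- By the theorem of Cayley and Hamilton, a matrix of order two modulo sign has trace zero. -/
theorem trace_eq_zero_of_involution {M : SL(2, ℝ)} (h1 : (QuotientGroup.mk M : PSL(2, ℝ)) ≠ 1)
    (h2 : (QuotientGroup.mk M : PSL(2, ℝ)) * QuotientGroup.mk M = 1) : M 1 1 = -M 0 0 := by
  rw [Ne, QuotientGroup.eq_one_iff, mem_center_iff_entries] at h1
  rw [← QuotientGroup.mk_mul, QuotientGroup.eq_one_iff, mem_center_iff_entries] at h2
  simp only [mul_entry] at h2
  obtain ⟨h3, h4, h5⟩ := h2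
  by_contra hne
  have hne' : M 0 0 + M 1 1 ≠ 0 := fun h => hne (by linarith)
  refine h1 ⟨?_, ?_, ?_⟩
  · exact (mul_eq_zero.mp (show M 0 1 * (M 0 0 + M 1 1) = 0 by linarith)).resolve_right hne'
  · exact (mul_eq_zero.mp (show M 1 0 * (M 0 0 + M 1 1) = 0 by linarith)).resolve_right hne'
  · have := (mul_eq_zero.mp
      (show (M 0 0 - M 1 1) * (M 0 0 + M 1 1) = 0 by linarith)).resolve_right hne'
    linarith

theorem entries_of_involution_of_fixed {M : SL(2, ℝ)} (htr : M 1 1 = -M 0 0) {z : ℍ}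
    (hz : M • z = z) :
    M 0 0 = M 1 0 * z.re ∧ M 0 1 = -(M 1 0 * (z.re ^ 2 + z.im ^ 2)) ∧ (M 1 0 * z.im) ^ 2 = 1 := by
  have h1 := congrArg (fun w : ℍ => (w : ℂ)) hz
  simp only [UpperHalfPlane.coe_specialLinearGroup_apply] at h1
  have hden : ((M 1 0 : ℝ) : ℂ) * z + ((M 1 1 : ℝ) : ℂ) ≠ 0 := by
    intro h0
    have him := congrArg Complex.im h0
    have hre := congrArg Complex.re h0
    simp at him hre
    rcases him with him | him
    · rw [him] at hre
      have hd := det_entries M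
      rw [him] at hd
      have : M 1 1 = 0 := by linarith
      rw [this] at hd
      linarith
    · exact z.im_pos.ne' him
  simp only [Algebra.algebraMap_self, RingHom.id_apply] at h1
  rw [div_eq_iff hden] at h1
  have hre := congrArg Complex.re h1
  have him := congrArg Complex.im h1
  simp at hre him
  have hy := z.im_pos
  have h2 : M 0 0 = M 1 0 * z.re := by
    have : z.im * (M 0 0 - M 1 0 * z.re) = 0 := by rw [htr] at him; linarith
    have := (mul_eq_zero.mp this).resolve_left hy.ne'
    linarith
  have h3 : M 0 1 = -(M 1 0 * (z.re ^ 2 + z.im ^ 2)) := by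
    rw [htr, h2] at hre; linarith
  refine ⟨h2, h3, ?_⟩
  have hd := det_entries M
  rw [htr, h3, h2] at hd
  linarith

/-- An involution of `PSL(2, ℝ)` is determined by a fixed point. -/
theorem involution_eq_of_fixed {g h : PSL(2, ℝ)} (hg : g ≠ 1) (hg2 : g * g = 1) (hh : h ≠ 1)
    (hh2 : h * h = 1) {z : ℍ} (hgz : g • z = z) (hhz : h • z = z) : g = h := by
  obtain ⟨M, rfl⟩ := QuotientGroup.mk_surjective g
  obtain ⟨N, rfl⟩ := QuotientGroup.mk_surjective h
  rw [mk_smul] at hgz hhz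
  have htM := trace_eq_zero_of_involution hg hg2
  have htN := trace_eq_zero_of_involution hh hh2
  obtain ⟨a1, a2, a3⟩ := entries_of_involution_of_fixed htM hgz
  obtain ⟨b1, b2, b3⟩ := entries_of_involution_of_fixed htN hhz
  have hy := z.im_pos.ne'
  rcases sq_eq_sq_iff_eq_or_eq_neg.mp (b3.trans a3.symm) with h | h
  · have h10 : N 1 0 = M 1 0 := mul_right_cancel₀ hy h
    have : M = N := by
      ext i j
      fin_cases i <;> fin_cases j <;> simp [htM, htN, a1, a2, b1, b2, h10]
    rw [this]
  · have h10 : N 1 0 = -M 1 0 := mul_right_cancel₀ hy (by linarith)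
    apply mk_eq_of_entries_neg
    intro i j
    fin_cases i <;> fin_cases j <;> simp [htM, htN, a1, a2, b1, b2, h10]

/-- The product of two distinct involutions of `PSL(2, ℝ)` is hyperbolic. -/
theorem isHyperbolic_mul_of_involution {g h : PSL(2, ℝ)} (hg : g ≠ 1) (hg2 : g * g = 1)
    (hh : h ≠ 1) (hh2 : h * h = 1) (hne : g ≠ h) : IsHyperbolic (g * h) := by
  obtain ⟨M, rfl⟩ := QuotientGroup.mk_surjective g
  obtain ⟨N, rfl⟩ := QuotientGroup.mk_surjective h
  have htM := trace_eq_zero_of_involution hg hg2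
  have htN := trace_eq_zero_of_involution hh hh2
  refine ⟨M * N, rfl, ?_⟩
  rw [Matrix.IsHyperbolic, Matrix.discr_fin_two, (M * N).det_coe, Matrix.trace_fin_two,
    mul_entry, mul_entry]
  have hM := det_entries M
  have hN := det_entries N
  rw [htM] at hM ⊢
  rw [htN] at hN ⊢
  have hcM : M 1 0 ≠ 0 := fun h0 => by rw [h0] at hM; nlinarith [sq_nonneg (M 0 0)]
  have hcN : N 1 0 ≠ 0 := fun h0 => by rw [h0] at hN; nlinarith [sq_nonneg (N 0 0)]
  set a := M 0 0
  set b := M 0 1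
  set c := M 1 0
  set a' := N 0 0
  set b' := N 0 1
  set c' := N 1 0
  have key : c * c' * (a * a' + b * c' + (c * b' + -a * -a'))
      = -((a * c' - a' * c) ^ 2 + c ^ 2 + c' ^ 2) := by
    linear_combination (-c' ^ 2) * hM - c ^ 2 * hN
  set T := a * a' + b * c' + (c * b' + -a * -a')
  have hcc : 0 < (c * c') ^ 2 := by positivity
  by_contra! hle
  have hT : ((a * c' - a' * c) ^ 2 + c ^ 2 + c' ^ 2) ^ 2 ≤ 4 * (c * c') ^ 2 := by
    have : ((a * c' - a' * c) ^ 2 + c ^ 2 + c' ^ 2) ^ 2 = (c * c') ^ 2 * T ^ 2 := by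
      rw [← mul_pow, key]; ring
    rw [this]
    nlinarith
  have h1 : (a * c' - a' * c) ^ 2 = 0 := by
    nlinarith [sq_nonneg (a * c' - a' * c), sq_nonneg (c ^ 2 - c' ^ 2), sq_pos_of_ne_zero hcM,
      sq_pos_of_ne_zero hcN]
  have h2 : (c ^ 2 - c' ^ 2) ^ 2 = 0 := by
    rw [h1] at hT
    nlinarith [sq_nonneg (c ^ 2 - c' ^ 2)]
  have h3 : a * c' = a' * c := by
    have := pow_eq_zero_iff (two_ne_zero) |>.mp h1
    linarith
  have h4 : c' ^ 2 = c ^ 2 := by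
    have := pow_eq_zero_iff (two_ne_zero) |>.mp h2
    linarith
  apply hne
  rcases sq_eq_sq_iff_eq_or_eq_neg.mp h4 with h5 | h5
  · rw [h5] at h3 hN
    have ha : a = a' := mul_right_cancel₀ hcM h3
    have hb : b = b' := mul_right_cancel₀ hcM (by rw [← ha] at hN; linarith)
    congr 1
    ext i j
    fin_cases i <;> fin_cases j
    exacts [ha, hb, h5.symm, by simpa [htM, htN] using ha]
  · rw [h5] at h3 hN
    have ha : a' = -a := mul_right_cancel₀ hcM (by linarith)
    have hb : b' = -b := mul_right_cancel₀ hcM (by rw [ha] at hN; linarith)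
    apply mk_eq_of_entries_neg
    intro i j
    fin_cases i <;> fin_cases j
    exacts [ha, hb, h5, by simp [htM, htN, ha]]

/-! ### The Hecke group as a free product -/

/-- Represented by a matrix with nonnegative entries, not all off-diagonal ones zero, and with
positive diagonal. -/
def IsPos (g : PSL(2, ℝ)) : Prop :=
  ∃ M : SL(2, ℝ), (QuotientGroup.mk M : PSL(2, ℝ)) = g ∧ 0 < M 0 0 ∧ 0 < M 1 1 ∧ 0 ≤ M 0 1 ∧
    0 ≤ M 1 0 ∧ 0 < M 0 1 + M 1 0

theorem IsPos.mul {g h : PSL(2, ℝ)} (hg : IsPos g) (hh : IsPos h) : IsPos (g * h) := by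
  obtain ⟨M, rfl, a1, a2, a3, a4, a5⟩ := hg
  obtain ⟨N, rfl, b1, b2, b3, b4, b5⟩ := hh
  refine ⟨M * N, rfl, ?_, ?_, ?_, ?_, ?_⟩ <;> simp only [mul_entry]
  · positivity
  · positivity
  · positivity
  · positivity
  · have h1 := mul_pos a1 b1
    have h2 := mul_pos a2 b2
    have h3 : 0 ≤ M 0 0 * N 0 1 := by positivity
    have h4 : 0 ≤ M 1 1 * N 1 0 := by positivity
    have h5 : 0 ≤ M 0 1 * N 1 1 := by positivity
    have h6 : 0 ≤ M 1 0 * N 0 0 := by positivity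
    rcases b3.lt_or_eq with h | h
    · nlinarith [mul_pos a1 h]
    · nlinarith [mul_pos a2 (show 0 < N 1 0 by linarith)]

theorem not_isPos_one : ¬ IsPos 1 := by
  rintro ⟨M, hM, -, -, -, -, h⟩
  rw [QuotientGroup.eq_one_iff, mem_center_iff_entries] at hM
  rw [hM.1, hM.2.1] at h
  simp at h

theorem not_isPos_genA : ¬ IsPos genA := by
  rintro ⟨M, hM, h, -⟩
  rcases eq_or_eq_neg_of_mk_eq hM.symm with h1 | h1 <;>
  · rw [h1] at h
    simp [matA] at h

/-- The entries of `B ^ n`, multiplied by `sin (π / k)`. -/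
theorem matB_pow_entries (k n : ℕ) :
    (matB k ^ n) 0 0 * Real.sin (Real.pi / k) = -Real.sin ((n - 1) * (Real.pi / k)) ∧
    (matB k ^ n) 0 1 * Real.sin (Real.pi / k) = -Real.sin (n * (Real.pi / k)) ∧
    (matB k ^ n) 1 0 * Real.sin (Real.pi / k) = Real.sin (n * (Real.pi / k)) ∧
    (matB k ^ n) 1 1 * Real.sin (Real.pi / k) = Real.sin ((n + 1) * (Real.pi / k)) := by
  set θ := Real.pi / k with hθ
  have e1 : ∀ x : ℝ, Real.sin ((x + 1) * θ)
      = 2 * Real.cos θ * Real.sin (x * θ) - Real.sin ((x - 1) * θ) := by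
    intro x
    rw [add_mul, sub_mul, one_mul, Real.sin_add, Real.sin_sub]; ring
  induction n with
  | zero => simp
  | succ n ih =>
    obtain ⟨h1, h2, h3, h4⟩ := ih
    have b00 : (matB k) 0 0 = 0 := rfl
    have b01 : (matB k) 0 1 = -1 := rfl
    have b10 : (matB k) 1 0 = 1 := rfl
    have b11 : (matB k) 1 1 = 2 * Real.cos θ := rfl
    rw [pow_succ]
    simp only [mul_entry, b00, b01, b10, b11]
    push_cast
    refine ⟨?_, ?_, ?_, ?_⟩
    · rw [add_sub_cancel_right]; linarith
    · rw [e1]; linear_combination -h1 + 2 * Real.cos θ * h2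
    · linarith
    · rw [e1 (n + 1), add_sub_cancel_right]; linear_combination -h3 + 2 * Real.cos θ * h4

theorem sin_pi_div_pos {k : ℕ} (hk : 3 ≤ k) : 0 < Real.sin (Real.pi / k) := (fixB k hk).im_pos

theorem genB_pow_self {k : ℕ} (hk : 3 ≤ k) : genB k ^ k = 1 := by
  obtain ⟨h1, h2, h3, h4⟩ := matB_pow_entries k k
  have hs := sin_pi_div_pos hk
  have hk0 : (k : ℝ) ≠ 0 := by exact_mod_cast (by omega : k ≠ 0)
  have e : (k : ℝ) * (Real.pi / k) = Real.pi := by field_simp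
  rw [sub_mul, one_mul, e, Real.sin_pi_sub] at h1
  rw [e, Real.sin_pi] at h2 h3
  rw [add_mul, one_mul, e, Real.sin_add, Real.sin_pi, Real.cos_pi] at h4
  rw [genB, ← QuotientGroup.mk_pow, QuotientGroup.eq_one_iff, mem_center_iff_entries]
  refine ⟨?_, ?_, mul_right_cancel₀ hs.ne' (by rw [h1, h4]; ring)⟩
  · exact (mul_eq_zero.mp (by simpa using h2)).resolve_right hs.ne'
  · exact (mul_eq_zero.mp h3).resolve_right hs.ne'

/-- For `0 < j < k` all entries of `-(A * B ^ j)` are nonnegative. -/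
theorem isPos_genA_mul_genB_pow {k : ℕ} (hk : 3 ≤ k) {j : ℕ} (hj0 : 0 < j) (hjk : j < k) :
    IsPos (genA * genB k ^ j) := by
  obtain ⟨h1, h2, h3, h4⟩ := matB_pow_entries k j
  have hs := sin_pi_div_pos hk
  set θ := Real.pi / k with hθ
  have hk0 : (0 : ℝ) < k := by exact_mod_cast (by omega : 0 < k)
  have hθ0 : 0 < θ := by positivity
  have hkθ : k * θ = Real.pi := by rw [hθ]; field_simp
  have hj1 : (1 : ℝ) ≤ j := by exact_mod_cast hj0
  have hj2 : (j : ℝ) + 1 ≤ k := by exact_mod_cast hjk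
  have hsj : 0 < Real.sin (j * θ) :=
    Real.sin_pos_of_pos_of_lt_pi (by positivity) (by rw [← hkθ]; nlinarith)
  have hsj1 : 0 ≤ Real.sin ((j + 1) * θ) :=
    Real.sin_nonneg_of_nonneg_of_le_pi (by positivity) (by rw [← hkθ]; nlinarith)
  have hsj2 : 0 ≤ Real.sin ((j - 1) * θ) :=
    Real.sin_nonneg_of_nonneg_of_le_pi (mul_nonneg (by linarith) hθ0.le)
      (by rw [← hkθ]; nlinarith)
  have hcos : 0 < Real.cos θ := by
    refine Real.cos_pos_of_mem_Ioo ⟨by linarith [Real.pi_pos], ?_⟩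
    have : (3 : ℝ) ≤ k := by exact_mod_cast hk
    nlinarith
  have hsum : 0 < Real.sin ((j + 1) * θ) + Real.sin ((j - 1) * θ) := by
    rw [add_mul, sub_mul, one_mul, Real.sin_add, Real.sin_sub]
    nlinarith [mul_pos hsj hcos]
  have a00 : matA 0 0 = 0 := rfl
  have a01 : matA 0 1 = -1 := rfl
  have a10 : matA 1 0 = 1 := rfl
  have a11 : matA 1 1 = 0 := rfl
  refine ⟨-(matA * matB k ^ j), by rw [mk_neg_eq]; rfl, ?_⟩
  have e : ∀ p q, (-(matA * matB k ^ j)) p q = -(matA * matB k ^ j) p q := fun _ _ => rfl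
  simp only [e, mul_entry, a00, a01, a10, a11]
  have pos_of : ∀ x : ℝ, 0 < x * Real.sin θ → 0 < x :=
    fun x hx => (pos_iff_pos_of_mul_pos hx).mpr hs
  have nonneg_of : ∀ x : ℝ, 0 ≤ x * Real.sin θ → 0 ≤ x :=
    fun x hx => nonneg_of_mul_nonneg_left hx hs
  refine ⟨pos_of _ ?_, pos_of _ ?_, nonneg_of _ ?_, nonneg_of _ ?_, pos_of _ ?_⟩ <;> linarith

theorem genA_mul_self : genA * genA = 1 := by
  rw [genA, ← QuotientGroup.mk_mul, QuotientGroup.eq_one_iff, mem_center_iff_entries]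
  simp only [mul_entry]
  simp [matA]

theorem genA_ne_one : genA ≠ 1 := by
  rw [genA, Ne, QuotientGroup.eq_one_iff, mem_center_iff_entries]
  simp [matA]

theorem isPos_wordProd {k : ℕ} (hk : 3 ≤ k) {l : List (ZMod k)} (hl : l ≠ [])
    (h0 : ∀ x ∈ l, x ≠ 0) : IsPos (wordProd genA (genB k) l) := by
  have : NeZero k := ⟨by omega⟩
  induction l with
  | nil => exact absurd rfl hl
  | cons x l ih =>
    simp only [List.mem_cons, forall_eq_or_imp] at h0
    have hx : IsPos (genA * genB k ^ x.val) :=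
      isPos_genA_mul_genB_pow hk (by have := (ZMod.val_ne_zero x).mpr h0.1; omega) (ZMod.val_lt x)
    rw [wordProd_cons]
    by_cases hl' : l = []
    · simpa [hl'] using hx
    · exact hx.mul (ih hl' h0.2)

/-- `A` as an element of the Hecke group. -/
noncomputable def heckeA (k : ℕ) : heckeGroup k := ⟨genA, Subgroup.subset_closure (by simp)⟩

/-- `B` as an element of the Hecke group. -/
noncomputable def heckeB (k : ℕ) : heckeGroup k := ⟨genB k, Subgroup.subset_closure (by simp)⟩

theorem closure_heckeA_heckeB (k : ℕ) : Subgroup.closure {heckeA k, heckeB k} = ⊤ := by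
  refine Eq.trans ?_ (Subgroup.closure_closure_coe_preimage (k := {genA, genB k}))
  congr 1
  ext x
  simp only [Set.mem_insert_iff, Set.mem_singleton_iff]
  exact or_congr Subtype.ext_iff Subtype.ext_iff

theorem heckeA_mul_self (k : ℕ) : heckeA k * heckeA k = 1 := Subtype.ext genA_mul_self

theorem heckeB_pow_self {k : ℕ} (hk : 3 ≤ k) : heckeB k ^ k = 1 := Subtype.ext (genB_pow_self hk)

/-- The universal property of the free product of the subgroups generated by `A` and `B`, for the
Hecke group: elements with `α ^ 2 = β ^ k = 1` define a homomorphism. The subgroup of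
`heckeGroup k × H` generated by `(A, α)` and `(B, β)` is the graph of the homomorphism; it is a
graph because a nonempty word in the syllables `A * B ^ x` is positive, so neither `1` nor `A`. -/
theorem exists_hom {k : ℕ} (hk : 3 ≤ k) {H : Type*} [Group H] {α β : H} (hα : α * α = 1)
    (hβ : β ^ k = 1) : ∃ ψ : heckeGroup k →* H, ψ (heckeA k) = α ∧ ψ (heckeB k) = β := by
  have : NeZero k := ⟨by omega⟩
  let a : heckeGroup k × H := (heckeA k, α)
  let b : heckeGroup k × H := (heckeB k, β)
  let K : Subgroup (heckeGroup k × H) := Subgroup.closure {a, b}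
  have ha : a * a = 1 := Prod.ext (heckeA_mul_self k) hα
  have hb : b ^ k = 1 := Prod.ext (heckeB_pow_self hk) hβ
  let f : K →* heckeGroup k := (MonoidHom.fst _ _).comp K.subtype
  have hA1 : heckeA k ≠ 1 := fun h => genA_ne_one (congrArg Subtype.val h)
  have hinj : Function.Injective f := by
    rw [injective_iff_map_eq_one]
    rintro ⟨g, hg⟩ h1
    obtain ⟨s, t, l, hs, ht, hl, rfl⟩ := exists_normalForm ha hb hg
    -- the first component of the word is `1` or `A`, so the word is empty by positivity
    have hw : l = [] := by
      by_contra hne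
      have hpos := isPos_wordProd hk hne hl
      have e1 : s.1 * (wordProd a b l).1 * t.1 = 1 := h1
      have e2 : (wordProd a b l).1 = wordProd (heckeA k) (heckeB k) l :=
        map_wordProd (a := a) (b := b) (MonoidHom.fst (heckeGroup k) H) l
      have e3 : ((wordProd (heckeA k) (heckeB k) l : heckeGroup k) : PSL(2, ℝ))
          = wordProd genA (genB k) l := map_wordProd (heckeGroup k).subtype l
      rw [e2] at e1
      have e4 : wordProd (heckeA k) (heckeB k) l = s.1⁻¹ * t.1⁻¹ := by
        rwa [eq_inv_mul_iff_mul_eq, eq_inv_iff_mul_eq_one]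
      rw [← e3, e4] at hpos
      have hAi : (heckeA k)⁻¹ = heckeA k := inv_eq_of_mul_eq_one_right (heckeA_mul_self k)
      rcases hs with rfl | rfl <;> rcases ht with rfl | rfl
      · simp only [Prod.fst_one, inv_one, mul_one] at hpos; exact not_isPos_one hpos
      · simp only [a, Prod.fst_one, inv_one, one_mul, hAi] at hpos; exact not_isPos_genA hpos
      · simp only [a, Prod.fst_one, inv_one, mul_one, hAi] at hpos; exact not_isPos_genA hpos
      · simp only [a, hAi, heckeA_mul_self] at hpos; exact not_isPos_one hpos
    subst hw
    apply Subtype.ext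
    have e1 : s.1 * t.1 = 1 := by
      have e2 : (s * wordProd a b [] * t).1 = 1 := h1
      simpa using e2
    simp only [wordProd_nil, mul_one]
    rcases hs with rfl | rfl <;> rcases ht with rfl | rfl
    · simp
    · exact absurd (by simpa using e1) hA1
    · exact absurd (by simpa using e1) hA1
    · exact ha
  have hmem : ∀ g : heckeGroup k, ∃ h : H, (g, h) ∈ K := by
    intro g
    have hg : g ∈ Subgroup.closure {heckeA k, heckeB k} :=
      closure_heckeA_heckeB k ▸ Subgroup.mem_top g
    induction hg using Subgroup.closure_induction with
    | mem x hx =>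
      rcases hx with rfl | rfl
      · exact ⟨α, Subgroup.subset_closure (by simp [a])⟩
      · exact ⟨β, Subgroup.subset_closure (by simp [b])⟩
    | one => exact ⟨1, K.one_mem⟩
    | mul x y _ _ hx hy =>
      obtain ⟨h, hh⟩ := hx
      obtain ⟨h', hh'⟩ := hy
      exact ⟨h * h', K.mul_mem hh hh'⟩
    | inv x _ hx =>
      obtain ⟨h, hh⟩ := hx
      exact ⟨h⁻¹, K.inv_mem hh⟩
  let e : K ≃* heckeGroup k := MulEquiv.ofBijective f ⟨hinj, fun g => by
    obtain ⟨h, hh⟩ := hmem g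
    exact ⟨⟨(g, h), hh⟩, rfl⟩⟩
  have he : ∀ x (hx : x ∈ K), (e.symm x.1).1.2 = x.2 := fun x hx => by
    have : e.symm x.1 = ⟨x, hx⟩ := by rw [MulEquiv.symm_apply_eq]; rfl
    rw [this]
  refine ⟨((MonoidHom.snd _ _).comp K.subtype).comp e.symm.toMonoidHom, ?_, ?_⟩
  · exact he a (Subgroup.subset_closure (by simp))
  · exact he b (Subgroup.subset_closure (by simp))

/-! ### Reciprocal geodesics and involutions -/

/-- Since an involution is determined by its fixed point, those whose fixed point lies over the
image of the fixed point of `c` are the conjugates of `c`. -/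
theorem fixesOver_iff_isConj {k : ℕ} {c : heckeGroup k} (hc : c ≠ 1) (hc2 : c * c = 1) {z₀ : ℍ}
    (hz₀ : c • z₀ = z₀) {u : heckeGroup k} (hu : u ≠ 1) (hu2 : u * u = 1) :
    FixesOver (proj k z₀) u ↔ IsConj c u := by
  have involution_of : ∀ {u v : heckeGroup k} {z : ℍ}, u ≠ 1 → u * u = 1 → v ≠ 1 → v * v = 1 →
      u • z = z → v • z = z → u = v := by
    intro u v z hu hu2 hv hv2 huz hvz
    exact Subtype.ext (involution_eq_of_fixed (fun h => hu (Subtype.ext h))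
      (congrArg Subtype.val hu2) (fun h => hv (Subtype.ext h)) (congrArg Subtype.val hv2) huz hvz)
  have hconj : ∀ g : heckeGroup k, g * c * g⁻¹ ≠ 1 ∧ (g * c * g⁻¹) * (g * c * g⁻¹) = 1 := by
    intro g
    refine ⟨fun h => hc (conj_eq_one_iff.mp h), ?_⟩
    have : (g * c * g⁻¹) * (g * c * g⁻¹) = g * (c * c) * g⁻¹ := by group
    rw [this, hc2]; group
  have hfix : ∀ g : heckeGroup k, (g * c * g⁻¹) • (g • z₀) = g • z₀ := by
    intro g
    rw [← mul_smul, inv_mul_cancel_right, mul_smul, hz₀]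
  constructor
  · rintro ⟨⟨z, hz⟩, h⟩
    have h1 : (MulAction.orbitRel (heckeGroup k) ℍ) z z₀ := Quotient.exact (h z hz)
    obtain ⟨g, rfl⟩ := MulAction.orbitRel_apply.mp h1
    exact isConj_iff.mpr ⟨g, involution_of (hconj g).1 (hconj g).2 hu hu2 (hfix g) hz⟩
  · intro h
    obtain ⟨g, rfl⟩ := isConj_iff.mp h
    refine ⟨⟨g • z₀, hfix g⟩, fun z hz => ?_⟩
    obtain ⟨M, hM⟩ := QuotientGroup.mk_surjective ((g * c * g⁻¹ : heckeGroup k) : PSL(2, ℝ))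
    have hz1 : M • z = z := by rw [← mk_smul, hM]; exact hz
    have hz2 : M • (g • z₀) = g • z₀ := by rw [← mk_smul, hM]; exact hfix g
    have htr : M 1 1 = -M 0 0 := trace_eq_zero_of_involution
      (by rw [hM]; exact fun h => (hconj g).1 (Subtype.ext h))
      (by rw [hM]; exact congrArg Subtype.val (hconj g).2)
    obtain ⟨a1, a2, a3⟩ := entries_of_involution_of_fixed htr hz1
    obtain ⟨b1, b2, b3⟩ := entries_of_involution_of_fixed htr hz2
    have hc0 : M 1 0 ≠ 0 := fun h0 => by rw [h0] at a3; simp at a3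
    have hre : z.re = (g • z₀).re := mul_left_cancel₀ hc0 (a1.symm.trans b1)
    have him : z.im = (g • z₀).im := by
      have h2 : z.im ^ 2 = (g • z₀).im ^ 2 := by
        refine mul_left_cancel₀ (pow_ne_zero 2 hc0) ?_
        rw [← mul_pow, ← mul_pow, a3, b3]
      exact (pow_left_inj₀ z.im_pos.le (g • z₀).im_pos.le two_ne_zero).mp h2
    have hzz : z = g • z₀ := UpperHalfPlane.ext_re_im hre him
    rw [hzz]
    exact Quotient.sound (MulAction.orbitRel_apply.mpr ⟨g, rfl⟩)

/-- Up to conjugacy, a reciprocal element is the product of a conjugate of the involution `c`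
fixing a given lift of the cone point, and of `c` itself. -/
theorem mem_reciprocalGeodesics_iff {k : ℕ} {c : heckeGroup k} (hc : c ≠ 1) (hc2 : c * c = 1)
    {z₀ : ℍ} (hz₀ : c • z₀ = z₀) {γ : ConjClasses (heckeGroup k)} :
    γ ∈ reciprocalGeodesics (proj k z₀) ↔
      ∃ g : heckeGroup k, g * c * g⁻¹ ≠ c ∧ γ = ConjClasses.mk (g * c * g⁻¹ * c) := by
  have hord : ∀ u : heckeGroup k, orderOf u = 2 ↔ u ≠ 1 ∧ u * u = 1 := by
    intro u
    have : Fact (Nat.Prime 2) := ⟨Nat.prime_two⟩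
    rw [orderOf_eq_prime_iff, pow_two, and_comm]
  constructor
  · rintro ⟨w, rfl, -, u, v, hu, hv, huv, -, hfu, hfv, rfl⟩
    rw [hord] at hu hv
    obtain ⟨g, rfl⟩ := isConj_iff.mp ((fixesOver_iff_isConj hc hc2 hz₀ hu.1 hu.2).mp hfu)
    obtain ⟨h, rfl⟩ := isConj_iff.mp ((fixesOver_iff_isConj hc hc2 hz₀ hv.1 hv.2).mp hfv)
    refine ⟨h⁻¹ * g, fun he => huv ?_, ConjClasses.mk_eq_mk_iff_isConj.mpr
      (isConj_iff.mpr ⟨h⁻¹, ?_⟩)⟩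
    · calc g * c * g⁻¹ = h * (h⁻¹ * g * c * (h⁻¹ * g)⁻¹) * h⁻¹ := by group
        _ = h * c * h⁻¹ := by rw [he]
    · group
  · rintro ⟨g, hne, rfl⟩
    have hconj : IsConj c (g * c * g⁻¹) := isConj_iff.mpr ⟨g, rfl⟩
    have h1 : g * c * g⁻¹ ≠ 1 := fun h => hc (conj_eq_one_iff.mp h)
    have h2 : (g * c * g⁻¹) * (g * c * g⁻¹) = 1 := by
      have : (g * c * g⁻¹) * (g * c * g⁻¹) = g * (c * c) * g⁻¹ := by group
      rw [this, hc2]; group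
    refine ⟨_, rfl, ?_, g * c * g⁻¹, c, (hord _).mpr ⟨h1, h2⟩, (hord _).mpr ⟨hc, hc2⟩, hne,
      hconj.symm, (fixesOver_iff_isConj hc hc2 hz₀ h1 h2).mpr hconj,
      (fixesOver_iff_isConj hc hc2 hz₀ hc hc2).mpr (IsConj.refl c), rfl⟩
    exact isHyperbolic_mul_of_involution (fun h => h1 (Subtype.ext h)) (congrArg Subtype.val h2)
      (fun h => hc (Subtype.ext h)) (congrArg Subtype.val hc2) (fun h => hne (Subtype.ext h))

/-! ### Symmetric periodic sequences -/

/-- If two sequences are antisymmetric about the same point and are shifts of each other, then they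
are equal or differ by the half period, unless the half period is itself a period. -/
theorem shift_trichotomy {R : Type*} [AddGroup R] {f g : ℤ → R} {c p r : ℤ}
    (hf : ∀ i, f (c - i) = -f i) (hg : ∀ i, g (c - i) = -g i) (hgf : ∀ i, g i = f (i + p))
    (hr : ∀ i, f (i + 2 * r) = f i) :
    (∀ i, g i = f i) ∨ (∀ i, g i = f (i + r)) ∨ ∀ i, f (i + r) = f i := by
  have hp : Function.Periodic f (2 * p) := fun i => by
    have h1 := hg (i + p)
    rw [hgf, hgf] at h1
    have h2 : c - (i + p) + p = c - i := by ring
    have h3 : i + p + p = i + 2 * p := by ring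
    rw [h2, h3, hf, neg_inj] at h1
    exact h1.symm
  have hr' : Function.Periodic f (2 * r) := hr
  -- hence twice the greatest common divisor of `p` and `r` is a period
  set d : ℤ := (Int.gcd p r : ℤ) with hd
  have hper : ∀ n : ℤ, Function.Periodic f (2 * d * n) := fun n => by
    have h1 := ((hp.int_mul (Int.gcdA p r * n)).add_period (hr'.int_mul (Int.gcdB p r * n)))
    have e : (Int.gcdA p r * n : ℤ) * (2 * p) + (Int.gcdB p r * n : ℤ) * (2 * r) = 2 * d * n := by
      rw [hd, Int.gcd_eq_gcd_ab]; ring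
    simpa only [Int.cast_id, e] using h1
  obtain ⟨p', hp'⟩ : d ∣ p := Int.gcd_dvd_left p r
  obtain ⟨r', hr''⟩ : d ∣ r := Int.gcd_dvd_right p r
  rcases Int.even_or_odd' p' with ⟨x, hx | hx⟩
  · left
    intro i
    rw [hgf, ← hper x i, hp', hx]
    congr 1; ring
  · rcases Int.even_or_odd' r' with ⟨y, hy | hy⟩
    · right; right
      intro i
      rw [← hper y i, hr'', hy]
      congr 1; ring
    · right; left
      intro i
      rw [hgf, ← hper (x - y) (i + r), hp', hr'', hx, hy]
      congr 1; ring

/-- If a sequence is antisymmetric about a half-integer, and a shift of it about an integer, then it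
has an odd period, and so its half period is a period. -/
theorem half_period_of_odd_shift {R : Type*} [AddGroup R] {f g : ℤ → R} {p r : ℤ}
    (hf : ∀ i, f (-1 - i) = -f i) (hg : ∀ i, g (-i) = -g i) (hgf : ∀ i, g i = f (i + p))
    (hr : ∀ i, f (i + 2 * r) = f i) (i : ℤ) : f (i + r) = f i := by
  have hp : Function.Periodic f (2 * p + 1) := fun i => by
    have h1 := hg (-1 - i - p)
    rw [hgf, hgf] at h1
    have h2 : -(-1 - i - p) + p = i + (2 * p + 1) := by ring
    have h3 : -1 - i - p + p = -1 - i := by ring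
    rw [h2, h3, hf, neg_neg] at h1
    exact h1
  have hr' : Function.Periodic f (2 * r) := hr
  have h1 := ((hp.int_mul r).add_period (hr'.int_mul (-p))) i
  rw [← h1]
  congr 1
  simp only [Int.cast_id]
  ring

/-! ### Symmetric words -/

section words

variable {k : ℕ}

/-- The reversed list of negatives, the exponents of the inverse word. -/
def negRev (l : List (ZMod k)) : List (ZMod k) := (l.map Neg.neg).reverse

@[simp] theorem length_negRev (l : List (ZMod k)) : (negRev l).length = l.length := by
  simp [negRev]

@[simp] theorem negRev_negRev (l : List (ZMod k)) : negRev (negRev l) = l := by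
  simp [negRev, List.map_reverse]

@[simp] theorem negRev_append (l l' : List (ZMod k)) :
    negRev (l ++ l') = negRev l' ++ negRev l := by
  simp [negRev]

theorem negRev_cons (x : ZMod k) (l : List (ZMod k)) : negRev (x :: l) = negRev l ++ [-x] := by
  simp [negRev]

theorem ne_zero_of_mem_negRev {l : List (ZMod k)} (h : ∀ x ∈ l, x ≠ 0) :
    ∀ x ∈ negRev l, x ≠ 0 := by
  intro x hx
  simp only [negRev, List.mem_reverse, List.mem_map] at hx
  obtain ⟨y, hy, rfl⟩ := hx
  exact neg_ne_zero.mpr (h y hy)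

@[simp] theorem weight_append (l l' : List (ZMod k)) : weight (l ++ l') = weight l + weight l' := by
  simp [weight]

@[simp] theorem weight_cons (x : ZMod k) (l : List (ZMod k)) :
    weight (x :: l) = syllable x + 1 + weight l := by
  simp [weight]

@[simp] theorem weight_nil : weight ([] : List (ZMod k)) = 0 := rfl

@[simp] theorem weight_negRev (l : List (ZMod k)) : weight (negRev l) = weight l := by
  induction l with
  | nil => rfl
  | cons x l ih => rw [negRev_cons, weight_append, ih]; simp [syllable_neg]; ring

theorem getD_negRev (l : List (ZMod k)) {i : ℕ} (hi : i < l.length) :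
    (negRev l).getD i 0 = -l.getD (l.length - 1 - i) 0 := by
  rw [List.getD_eq_getElem _ _ (by simpa using hi), List.getD_eq_getElem _ _ (by omega)]
  simp [negRev]

theorem periodic_negRev (I : List (ZMod k)) (i : ℤ) :
    periodic (negRev I) i = -periodic I (-1 - i) := by
  rcases eq_or_ne I [] with rfl | hI
  · simp [periodic, negRev]
  have hn : 0 < I.length := List.length_pos_iff.mpr hI
  have h1 := Int.emod_nonneg i (b := I.length) (by omega)
  have h2 := Int.emod_lt_of_pos i (b := I.length) (by omega)
  obtain ⟨j, hj⟩ : ∃ j : ℕ, (j : ℤ) = i % I.length := ⟨(i % I.length).toNat, by omega⟩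
  have e1 : i = j + I.length * (i / I.length) := by
    rw [hj]; exact (Int.emod_add_mul_ediv i _).symm
  have e2 : -1 - i = (I.length - 1 - j : ℕ) + I.length * (-(i / I.length) - 1) := by
    rw [Nat.cast_sub (by omega), Nat.cast_sub (by omega)]
    push_cast
    linear_combination -e1
  have e3 : periodic (negRev I) i = periodic (negRev I) j := by
    conv_lhs => rw [e1, ← length_negRev I, periodic_add_mul]
  rw [e3, periodic_natCast (I := negRev I) (by rw [length_negRev]; omega),
    getD_negRev _ (by omega), e2, periodic_add_mul, periodic_natCast (by omega)]

theorem periodic_rotate (I : List (ZMod k)) (n : ℕ) (i : ℤ) :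
    periodic (I.rotate n) i = periodic I (i + n) := by
  rcases eq_or_ne I [] with rfl | hI
  · simp [periodic]
  have hn : 0 < I.length := List.length_pos_iff.mpr hI
  have h1 := Int.emod_nonneg i (b := I.length) (by omega)
  have h2 := Int.emod_lt_of_pos i (b := I.length) (by omega)
  have h3 := Int.emod_nonneg (i + n) (b := I.length) (by omega)
  have h4 := Int.emod_lt_of_pos (i + n) (b := I.length) (by omega)
  rw [periodic, periodic, List.length_rotate, List.getD_eq_getElem _ _ (by simp; omega),
    List.getD_eq_getElem _ _ (by omega), List.getElem_rotate]
  congr 1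
  zify
  rw [Int.toNat_of_nonneg h1, Int.toNat_of_nonneg h3]
  simp

theorem periodic_append_comm (l l' : List (ZMod k)) (i : ℤ) :
    periodic (l ++ l') (i + l.length) = periodic (l' ++ l) i := by
  rw [← periodic_rotate, List.rotate_append_length_eq]

theorem eq_of_periodic_eq {I J : List (ZMod k)} (hlen : I.length = J.length)
    (h : ∀ i, periodic I i = periodic J i) : I = J := by
  refine List.ext_getElem hlen fun i hi hj => ?_
  have := h i
  rw [periodic_natCast hi, periodic_natCast hj] at this
  rwa [List.getD_eq_getElem _ _ hi, List.getD_eq_getElem _ _ hj] at this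

/-- The exponents of a word for the product of two conjugates of `A`: if `l` are the exponents of
`w`, these are the exponents of `w * A * w⁻¹ * A`. -/
def wordTwo (l : List (ZMod k)) : List (ZMod k) := l ++ negRev l

/-- The exponents of a word for the product of two conjugates of `B ^ m`: if `l` are the exponents
of `w`, these are the exponents of a conjugate of `g * B ^ m * g⁻¹ * B ^ m`, where `g = w * A`. -/
def wordK (m : ℕ) (l : List (ZMod k)) : List (ZMod k) :=
  ((m : ZMod k) :: l) ++ ((m : ZMod k) :: negRev l)

theorem periodic_wordTwo_neg (l : List (ZMod k)) (i : ℤ) :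
    periodic (wordTwo l) (-1 - i) = -periodic (wordTwo l) i := by
  have h : negRev (wordTwo l) = wordTwo l := by simp [wordTwo]
  rw [← neg_eq_iff_eq_neg, ← periodic_negRev, h]

theorem periodic_wordTwo_add (l : List (ZMod k)) (i : ℤ) :
    periodic (wordTwo l) (i + l.length) = periodic (wordTwo (negRev l)) i := by
  rw [wordTwo, periodic_append_comm, wordTwo, negRev_negRev]

theorem periodic_wordTwo_period (l : List (ZMod k)) (i : ℤ) :
    periodic (wordTwo l) (i + 2 * l.length) = periodic (wordTwo l) i := by
  conv_rhs => rw [← periodic_add_length (wordTwo l)]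
  simp [wordTwo, two_mul]

theorem wordTwo_injective {l l' : List (ZMod k)} (h : wordTwo l = wordTwo l') : l = l' := by
  have h1 := congrArg List.length h
  simp only [wordTwo, List.length_append, length_negRev] at h1
  exact (List.append_inj h (by omega)).1

theorem neg_natCast_half {m : ℕ} : (-(m : ZMod (2 * m))) = m := by
  rw [neg_eq_iff_add_eq_zero, ← Nat.cast_add, ← two_mul, ZMod.natCast_self]

theorem val_natCast_half {m : ℕ} (hm : 0 < m) : ((m : ZMod (2 * m))).val = m := by
  rw [ZMod.val_natCast, Nat.mod_eq_of_lt (by omega)]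

theorem natCast_half_ne_zero {m : ℕ} (hm : 0 < m) : (m : ZMod (2 * m)) ≠ 0 := by
  intro h
  have := val_natCast_half hm
  rw [h] at this
  simp at this
  omega

theorem syllable_natCast_half {m : ℕ} (hm : 0 < m) : syllable (m : ZMod (2 * m)) = m := by
  have : NeZero (2 * m) := ⟨by omega⟩
  rw [syllable, ZMod.valMinAbs_natAbs_eq_min, val_natCast_half hm]
  omega

theorem negRev_wordK {m : ℕ} (l : List (ZMod (2 * m))) :
    negRev (wordK m l) = (wordK m l).rotate 1 := by
  simp [wordK, negRev_cons, neg_natCast_half]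

theorem periodic_wordK_neg {m : ℕ} (l : List (ZMod (2 * m))) (i : ℤ) :
    periodic (wordK m l) (-i) = -periodic (wordK m l) i := by
  have h := periodic_negRev (wordK m l) (-i - 1)
  rw [negRev_wordK, periodic_rotate, show -1 - (-i - 1) = i by ring] at h
  simpa using h

theorem periodic_wordK_add {m : ℕ} (l : List (ZMod k)) (i : ℤ) :
    periodic (wordK m l) (i + (l.length + 1 : ℕ)) = periodic (wordK m (negRev l)) i := by
  have h := periodic_append_comm ((m : ZMod k) :: l) ((m : ZMod k) :: negRev l) i
  rw [List.length_cons] at h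
  rw [wordK, h, wordK, negRev_negRev]

theorem periodic_wordK_period (m : ℕ) (l : List (ZMod k)) (i : ℤ) :
    periodic (wordK m l) (i + 2 * (l.length + 1 : ℕ)) = periodic (wordK m l) i := by
  conv_rhs => rw [← periodic_add_length (wordK m l)]
  congr 2
  simp [wordK]
  ring

theorem wordK_injective {m : ℕ} {l l' : List (ZMod k)} (h : wordK m l = wordK m l') : l = l' := by
  have h1 := congrArg List.length h
  simp only [wordK, List.length_append, length_negRev, List.length_cons] at h1
  exact (List.cons.inj (List.append_inj h (by simp; omega)).1).2

theorem weight_wordTwo (l : List (ZMod k)) : weight (wordTwo l) = 2 * weight l := by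
  simp [wordTwo, two_mul]

theorem weight_wordK {m : ℕ} (hm : 0 < m) (l : List (ZMod (2 * m))) :
    weight (wordK m l) = 2 * (weight l + (m + 1)) := by
  simp [wordK, syllable_natCast_half hm]
  ring

theorem ne_zero_of_mem_wordTwo {l : List (ZMod k)} (h : ∀ x ∈ l, x ≠ 0) :
    ∀ x ∈ wordTwo l, x ≠ 0 := by
  intro x hx
  rcases List.mem_append.mp hx with hx | hx
  exacts [h x hx, ne_zero_of_mem_negRev h x hx]

theorem ne_zero_of_mem_wordK {m : ℕ} (hm : 0 < m) {l : List (ZMod (2 * m))}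
    (h : ∀ x ∈ l, x ≠ 0) : ∀ x ∈ wordK m l, x ≠ 0 := by
  intro x hx
  simp only [wordK, List.mem_append, List.mem_cons] at hx
  rcases hx with (rfl | hx) | rfl | hx
  exacts [natCast_half_ne_zero hm, h x hx, natCast_half_ne_zero hm, ne_zero_of_mem_negRev h x hx]

end words

/-! ### Conjugacy classes of reciprocal geodesics as words -/

section classes

variable {G : Type*} [Group G] {a b : G}

theorem wordProd_negRev {k : ℕ} [NeZero k] (ha : a * a = 1) (hb : b ^ k = 1) (l : List (ZMod k)) :
    wordProd a b (negRev l) = a * (wordProd a b l)⁻¹ * a := by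
  induction l with
  | nil => simp [negRev, ha]
  | cons x l ih =>
    have hai : a⁻¹ = a := inv_eq_of_mul_eq_one_right ha
    rw [negRev_cons, wordProd_append, ih, wordProd_cons, wordProd_cons, wordProd_nil, mul_one,
      pow_val_neg hb, mul_inv_rev, mul_inv_rev, hai]
    have : ∀ u v : G, a * u * a * (a * v) = a * (u * (v * a)) * a := fun u v => by
      rw [mul_assoc (a * u), ← mul_assoc a a v, ha, one_mul, mul_assoc a, mul_assoc a, mul_assoc u,
        mul_assoc v, ha, mul_one]
    rw [this]

theorem wordProd_wordTwo {k : ℕ} [NeZero k] (ha : a * a = 1) (hb : b ^ k = 1)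
    (l : List (ZMod k)) :
    wordProd a b (wordTwo l) = wordProd a b l * a * (wordProd a b l)⁻¹ * a := by
  rw [wordTwo, wordProd_append, wordProd_negRev ha hb]
  group

theorem isConj_wordProd_wordK {m : ℕ} (hm : 0 < m) (ha : a * a = 1) (hb : b ^ (2 * m) = 1)
    (l : List (ZMod (2 * m))) :
    IsConj (wordProd a b l * a * b ^ m * (wordProd a b l * a)⁻¹ * b ^ m)
      (wordProd a b (wordK m l)) := by
  have : NeZero (2 * m) := ⟨by omega⟩
  have hai : a⁻¹ = a := inv_eq_of_mul_eq_one_right ha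
  have hbi : (b ^ m)⁻¹ = b ^ m := inv_eq_of_mul_eq_one_right (by rw [← pow_add, ← two_mul, hb])
  refine isConj_iff.mpr ⟨a * b ^ m, ?_⟩
  rw [wordK, wordProd_append, wordProd_cons, wordProd_cons, wordProd_negRev ha hb,
    val_natCast_half hm, mul_inv_rev, mul_inv_rev, hai, hbi]
  have e : b ^ m * (b ^ m * a) = a := by
    rw [← mul_assoc, ← pow_add, ← two_mul, hb, one_mul]
  simp only [mul_assoc, e]

/-- A product of two distinct conjugates of `a`, the second being `a`, is conjugate to a word given
by `wordTwo`: the outer factors `a` of the normal form of `g` can be conjugated away. -/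
theorem exists_wordTwo_of_conj {k : ℕ} [NeZero k] (ha : a * a = 1) (hb : b ^ k = 1)
    (hG : Subgroup.closure {a, b} = ⊤) {g : G} (hg : g * a * g⁻¹ ≠ a) :
    ∃ l : List (ZMod k), l ≠ [] ∧ (∀ x ∈ l, x ≠ 0) ∧
      IsConj (g * a * g⁻¹ * a) (wordProd a b (wordTwo l)) := by
  obtain ⟨s, t, l, hs, ht, hl, rfl⟩ := exists_normalForm ha hb (hG ▸ Subgroup.mem_top g)
  have hai : a⁻¹ = a := inv_eq_of_mul_eq_one_right ha
  have h1 : s * wordProd a b l * t * a * (s * wordProd a b l * t)⁻¹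
      = s * (wordProd a b l * a * (wordProd a b l)⁻¹) * s⁻¹ := by
    rcases ht with rfl | rfl
    · group
    · rw [mul_assoc _ t t, ha]
      simp only [mul_inv_rev, hai, mul_one, mul_assoc]
  have hsa : s * a * s⁻¹ = a := by
    rcases hs with rfl | rfl
    · simp
    · group
  rw [h1] at hg ⊢
  refine ⟨l, ?_, hl, ?_⟩
  · rintro rfl
    exact hg (by simpa using hsa)
  · rw [wordProd_wordTwo ha hb]
    refine isConj_iff.mpr ⟨s⁻¹, ?_⟩
    have hsa' : a * s = s * a := by rw [← mul_inv_eq_iff_eq_mul.mp hsa]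
    simp only [inv_inv, mul_assoc, hsa', inv_mul_cancel_left]

/-- The analogue for `b ^ m`: the outer powers of `b` in the normal form of `g` commute with `b ^ m`
and can be conjugated away. -/
theorem exists_wordK_of_conj {m : ℕ} (hm : 0 < m) (ha : a * a = 1) (hb : b ^ (2 * m) = 1)
    (hG : Subgroup.closure {a, b} = ⊤) {g : G} (hg : g * b ^ m * g⁻¹ ≠ b ^ m) :
    ∃ l : List (ZMod (2 * m)), (∀ x ∈ l, x ≠ 0) ∧
      IsConj (g * b ^ m * g⁻¹ * b ^ m) (wordProd a b (wordK m l)) := by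
  have : NeZero (2 * m) := ⟨by omega⟩
  obtain ⟨s, t, l, hs, ht, hl, rfl⟩ := exists_normalForm ha hb (hG ▸ Subgroup.mem_top g)
  have hai : a⁻¹ = a := inv_eq_of_mul_eq_one_right ha
  -- remove a power of `b` on the left
  obtain ⟨i, t', l', ht', hl', e1⟩ : ∃ (i : ℕ) (t' : G) (l' : List (ZMod (2 * m))),
      (t' = 1 ∨ t' = a) ∧ (∀ x ∈ l', x ≠ 0) ∧
      s * wordProd a b l * t = b ^ i * (wordProd a b l' * t') := by
    rcases hs with rfl | rfl
    · exact ⟨0, t, l, ht, hl, by simp⟩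
    · cases l with
      | nil =>
        rcases ht with rfl | rfl
        · exact ⟨0, s, [], .inr rfl, by simp, by simp⟩
        · exact ⟨0, 1, [], .inl rfl, by simp, by simp [ha]⟩
      | cons x l =>
        simp only [List.mem_cons, forall_eq_or_imp] at hl
        exact ⟨x.val, t, l, ht, hl.2, by
          rw [wordProd_cons, ← mul_assoc, ← mul_assoc, ha, one_mul, mul_assoc]⟩
  -- and on the right
  obtain ⟨j, e2⟩ : ∃ j : ℕ, wordProd a b l' * t' = b ^ j ∨ ∃ l'' : List (ZMod (2 * m)),
      (∀ x ∈ l'', x ≠ 0) ∧ wordProd a b l' * t' = wordProd a b l'' * a * b ^ j := by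
    rcases ht' with rfl | rfl
    · rcases List.eq_nil_or_concat' l' with rfl | ⟨l'', x, rfl⟩
      · exact ⟨0, .inl (by simp)⟩
      · refine ⟨x.val, .inr ⟨l'', fun y hy => hl' y (by simp [hy]), ?_⟩⟩
        simp [mul_assoc]
    · exact ⟨0, .inr ⟨l', hl', by simp⟩⟩
  have hcomm : ∀ j : ℕ, b ^ j * b ^ m * (b ^ j)⁻¹ = b ^ m := fun j => by
    rw [← pow_add, add_comm, pow_add, mul_inv_cancel_right]
  rw [e1] at hg ⊢
  rcases e2 with e2 | ⟨l'', hl'', e2⟩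
  · rw [e2, ← pow_add, hcomm] at hg
    exact absurd rfl hg
  · refine ⟨l'', hl'', IsConj.trans ?_ (isConj_wordProd_wordK hm ha hb l'')⟩
    refine isConj_iff.mpr ⟨(b ^ i)⁻¹, ?_⟩
    have e3 : ∀ h : G, h * b ^ j * b ^ m * (h * b ^ j)⁻¹ = h * b ^ m * h⁻¹ := fun h => by
      conv_rhs => rw [← hcomm j]
      group
    have e4 : ∀ h : G, b ^ i * h * b ^ m * (b ^ i * h)⁻¹ * b ^ m
        = b ^ i * (h * b ^ m * h⁻¹ * b ^ m) * (b ^ i)⁻¹ := fun h => by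
      have : b ^ m = (b ^ i)⁻¹ * b ^ m * b ^ i := by
        rw [mul_assoc, ← pow_add, add_comm, pow_add, inv_mul_cancel_left]
      conv_lhs => rw [mul_assoc _ _ (b ^ m)]; enter [2, 2]; rw [this]
      group
    rw [e4, e2, e3]
    group

end classes

/-! ### Reciprocal geodesics of the Hecke group as words -/

section geodesics

variable {k m : ℕ}

/-- The conjugacy class of a word in the Hecke group. -/
noncomputable def wordClass (I : List (ZMod k)) : ConjClasses (heckeGroup k) :=
  ConjClasses.mk (wordProd (heckeA k) (heckeB k) I)

theorem exists_act (hk : 3 ≤ k) : ∃ ψ : heckeGroup k →* Equiv.Perm (State k),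
    ψ (heckeA k) = State.permA k ∧ ψ (heckeB k) = State.permB 1 :=
  exists_hom hk State.permA_mul_self State.permB_one_pow_self

theorem wordProd_hecke_ne_one (hk : 3 ≤ k) {I : List (ZMod k)} (hI : I ≠ [])
    (h0 : ∀ x ∈ I, x ≠ 0) : wordProd (heckeA k) (heckeB k) I ≠ 1 := by
  have : NeZero k := ⟨by omega⟩
  obtain ⟨ψ, ha, hb⟩ := exists_act hk
  exact wordProd_ne_one ψ ha hb hI h0

theorem heckeA_ne_one (k : ℕ) : heckeA k ≠ 1 := fun h => genA_ne_one (congrArg Subtype.val h)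

theorem mem_reciprocal_two_iff (hk : 3 ≤ k) {γ : ConjClasses (heckeGroup k)} :
    γ ∈ reciprocalGeodesics (conePointTwo k) ↔
      ∃ l : List (ZMod k), l ≠ [] ∧ (∀ x ∈ l, x ≠ 0) ∧ γ = wordClass (wordTwo l) := by
  have : NeZero k := ⟨by omega⟩
  have hfix : heckeA k • UpperHalfPlane.I = UpperHalfPlane.I := genA_smul_I
  rw [conePointTwo, mem_reciprocalGeodesics_iff (heckeA_ne_one k) (heckeA_mul_self k) hfix]
  constructor
  · rintro ⟨g, hg, rfl⟩
    obtain ⟨l, hl, hl0, h⟩ := exists_wordTwo_of_conj (heckeA_mul_self k) (heckeB_pow_self hk)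
      (closure_heckeA_heckeB k) hg
    exact ⟨l, hl, hl0, ConjClasses.mk_eq_mk_iff_isConj.mpr h⟩
  · rintro ⟨l, hl, hl0, rfl⟩
    have e := wordProd_wordTwo (heckeA_mul_self k) (heckeB_pow_self hk) l
    refine ⟨wordProd (heckeA k) (heckeB k) l, fun h => ?_, by rw [wordClass, e]⟩
    rw [h, heckeA_mul_self] at e
    exact wordProd_hecke_ne_one hk (by simp [wordTwo, hl]) (ne_zero_of_mem_wordTwo hl0) e

theorem mem_reciprocal_k_iff (hm : 2 ≤ m) (hk : 3 ≤ 2 * m) {γ : ConjClasses (heckeGroup (2 * m))} :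
    γ ∈ reciprocalGeodesics (conePointK (2 * m) hk) ↔
      ∃ l : List (ZMod (2 * m)), (∀ x ∈ l, x ≠ 0) ∧ γ = wordClass (wordK m l) := by
  have : NeZero (2 * m) := ⟨by omega⟩
  have hfixB : heckeB (2 * m) • fixB (2 * m) hk = fixB (2 * m) hk := genB_smul_fixB _ hk
  have hfix : heckeB (2 * m) ^ m • fixB (2 * m) hk = fixB (2 * m) hk :=
    (MulAction.stabilizer (heckeGroup (2 * m)) (fixB (2 * m) hk)).pow_mem hfixB m
  have hB2 : heckeB (2 * m) ^ m * heckeB (2 * m) ^ m = 1 := by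
    rw [← pow_add, ← two_mul, heckeB_pow_self hk]
  have hB1 : heckeB (2 * m) ^ m ≠ 1 := fun h => by
    have h1 : genB (2 * m) ^ m = 1 := congrArg Subtype.val h
    have h2 := isPos_genA_mul_genB_pow hk (j := m) (by omega) (by omega)
    rw [h1, mul_one] at h2
    exact not_isPos_genA h2
  rw [conePointK, mem_reciprocalGeodesics_iff hB1 hB2 hfix]
  constructor
  · rintro ⟨g, hg, rfl⟩
    obtain ⟨l, hl0, h⟩ := exists_wordK_of_conj (by omega) (heckeA_mul_self _) (heckeB_pow_self hk)
      (closure_heckeA_heckeB _) hg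
    exact ⟨l, hl0, ConjClasses.mk_eq_mk_iff_isConj.mpr h⟩
  · rintro ⟨l, hl0, rfl⟩
    have e := isConj_wordProd_wordK (by omega) (heckeA_mul_self _) (heckeB_pow_self hk) l
    refine ⟨wordProd (heckeA _) (heckeB _) l * heckeA _, fun h => ?_,
      (ConjClasses.mk_eq_mk_iff_isConj.mpr e).symm⟩
    rw [h, hB2, isConj_one_right] at e
    exact wordProd_hecke_ne_one hk (by simp [wordK]) (ne_zero_of_mem_wordK (by omega) hl0) e

/-! ### The length of a class -/

theorem exists_word (g : heckeGroup k) : ∃ L : List PSL(2, ℝ),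
    (∀ x ∈ L, x = genA ∨ x = genB k ∨ x = (genB k)⁻¹) ∧ L.prod = (g : PSL(2, ℝ)) := by
  have hAi : (genA)⁻¹ = genA := inv_eq_of_mul_eq_one_right genA_mul_self
  obtain ⟨g, hg⟩ := g
  simp only
  induction hg using Subgroup.closure_induction_left with
  | one => exact ⟨[], by simp, by simp⟩
  | mul_left x hx y hy ih =>
    obtain ⟨L, hL, rfl⟩ := ih
    refine ⟨x :: L, ?_, by simp⟩
    simp only [List.mem_cons, forall_eq_or_imp]
    refine ⟨?_, hL⟩
    rcases hx with rfl | rfl <;> simp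
  | inv_mul_cancel x hx y hy ih =>
    obtain ⟨L, hL, rfl⟩ := ih
    refine ⟨x⁻¹ :: L, ?_, by simp⟩
    simp only [List.mem_cons, forall_eq_or_imp]
    refine ⟨?_, hL⟩
    rcases hx with rfl | rfl <;> simp [hAi]

theorem exists_word_wordProd [NeZero k] (hb : genB k ^ k = 1) (I : List (ZMod k)) :
    ∃ L : List PSL(2, ℝ), (∀ x ∈ L, x = genA ∨ x = genB k ∨ x = (genB k)⁻¹) ∧
      L.prod = wordProd genA (genB k) I ∧ L.length = weight I := by
  induction I with
  | nil => exact ⟨[], by simp, by simp, rfl⟩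
  | cons x I ih =>
    obtain ⟨L, hL, hprod, hlen⟩ := ih
    have hx := ZMod.val_lt x
    obtain ⟨L', hL', hprod', hlen'⟩ : ∃ L' : List PSL(2, ℝ),
        (∀ x ∈ L', x = genA ∨ x = genB k ∨ x = (genB k)⁻¹) ∧ L'.prod = genB k ^ x.val ∧
        L'.length = syllable x := by
      rw [syllable, ZMod.valMinAbs_natAbs_eq_min]
      rcases le_total x.val (k - x.val) with h | h
      · rw [min_eq_left h]
        exact ⟨List.replicate x.val (genB k), fun y hy => by simp [List.eq_of_mem_replicate hy],
          by simp, by simp⟩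
      · rw [min_eq_right h]
        refine ⟨List.replicate (k - x.val) (genB k)⁻¹,
          fun y hy => by simp [List.eq_of_mem_replicate hy], ?_, by simp⟩
        rw [List.prod_replicate, inv_pow, inv_eq_iff_mul_eq_one, ← pow_add,
          Nat.sub_add_cancel hx.le, hb]
    refine ⟨genA :: (L' ++ L), ?_, ?_, ?_⟩
    · simp only [List.mem_cons, List.mem_append]
      rintro y (rfl | hy | hy)
      exacts [.inl rfl, hL' y hy, hL y hy]
    · rw [List.prod_cons, List.prod_append, hprod, hprod', wordProd_cons, mul_assoc]
    · rw [List.length_cons, List.length_append, hlen, hlen', weight_cons]; ring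

theorem coe_wordProd_hecke (I : List (ZMod k)) :
    ((wordProd (heckeA k) (heckeB k) I : heckeGroup k) : PSL(2, ℝ)) = wordProd genA (genB k) I :=
  map_wordProd (heckeGroup k).subtype I

theorem exists_lift_word (L : List PSL(2, ℝ))
    (hL : ∀ x ∈ L, x = genA ∨ x = genB k ∨ x = (genB k)⁻¹) : ∃ L' : List (heckeGroup k),
      (∀ x ∈ L', x = heckeA k ∨ x = heckeB k ∨ x = (heckeB k)⁻¹) ∧ L'.length = L.length ∧
      ((L'.prod : heckeGroup k) : PSL(2, ℝ)) = L.prod := by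
  induction L with
  | nil => exact ⟨[], by simp, by simp, by simp⟩
  | cons x L ih =>
    simp only [List.mem_cons, forall_eq_or_imp] at hL
    obtain ⟨L', hL', hlen, hprod⟩ := ih hL.2
    obtain ⟨y, hy, hyx⟩ : ∃ y : heckeGroup k,
        (y = heckeA k ∨ y = heckeB k ∨ y = (heckeB k)⁻¹) ∧ (y : PSL(2, ℝ)) = x := by
      rcases hL.1 with rfl | rfl | rfl
      · exact ⟨heckeA k, by simp, rfl⟩
      · exact ⟨heckeB k, by simp, rfl⟩
      · exact ⟨(heckeB k)⁻¹, by simp, rfl⟩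
    refine ⟨y :: L', ?_, by simp [hlen],
      by rw [List.prod_cons, List.prod_cons, Subgroup.coe_mul, hprod, hyx]⟩
    simp only [List.mem_cons, forall_eq_or_imp]
    exact ⟨hy, hL'⟩

/-- The length of the class of a nonempty reduced word is its weight. -/
theorem classLength_wordClass (hk : 3 ≤ k) {I : List (ZMod k)} (hI : I ≠ [])
    (h0 : ∀ x ∈ I, x ≠ 0) : classLength (wordClass I) = weight I := by
  have : NeZero k := ⟨by omega⟩
  obtain ⟨ψ, ha, hb⟩ := exists_act hk
  have hlow : ∀ g : heckeGroup k, ConjClasses.mk g = wordClass I → weight I ≤ wordLength g := by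
    intro g hg
    refine le_csInf ?_ ?_
    · obtain ⟨L, hL, hprod⟩ := exists_word g
      exact ⟨_, L, hL, hprod, rfl⟩
    · rintro n ⟨L, hL, hprod, rfl⟩
      obtain ⟨L', hL', hlen, hprod'⟩ := exists_lift_word L hL
      have hg' : L'.prod = g := Subtype.ext (hprod'.trans hprod)
      rw [← hlen]
      refine weight_le_length ψ ha hb (closure_heckeA_heckeB k) hI h0 L' hL' ?_
      rw [hg']
      exact (ConjClasses.mk_eq_mk_iff_isConj.mp hg).symm
  refine le_antisymm ?_ (le_csInf ⟨_, _, rfl, rfl⟩ ?_)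
  · refine (Nat.sInf_le ⟨wordProd (heckeA k) (heckeB k) I, rfl, rfl⟩ :
      classLength (wordClass I) ≤ wordLength (wordProd (heckeA k) (heckeB k) I)).trans ?_
    obtain ⟨L, hL, hprod, hlen⟩ := exists_word_wordProd (genB_pow_self hk) I
    exact Nat.sInf_le ⟨L, hL, by rw [hprod, coe_wordProd_hecke], hlen⟩
  · rintro n ⟨g, hg, rfl⟩
    exact hlow g hg

theorem periodic_eq_of_wordClass_eq (hk : 3 ≤ k) {I J : List (ZMod k)} (hI : I ≠ [])
    (hI0 : ∀ x ∈ I, x ≠ 0) (hJ0 : ∀ x ∈ J, x ≠ 0) (h : wordClass I = wordClass J) :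
    I.length = J.length ∧ ∃ d : ℤ, ∀ i, periodic J i = periodic I (i + d) := by
  have : NeZero k := ⟨by omega⟩
  obtain ⟨ψ, ha, hb⟩ := exists_act hk
  exact periodic_eq_of_isConj ψ ha hb (closure_heckeA_heckeB k) hI hI0 hJ0
    (ConjClasses.mk_eq_mk_iff_isConj.mp h)

theorem wordClass_eq_of_append_comm (I J : List (ZMod k)) :
    wordClass (I ++ J) = wordClass (J ++ I) := by
  refine ConjClasses.mk_eq_mk_iff_isConj.mpr (isConj_iff.mpr
    ⟨(wordProd (heckeA k) (heckeB k) I)⁻¹, ?_⟩)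
  rw [wordProd_append, wordProd_append]
  group

theorem wordClass_wordTwo_negRev (l : List (ZMod k)) :
    wordClass (wordTwo (negRev l)) = wordClass (wordTwo l) := by
  rw [wordTwo, wordTwo, negRev_negRev, wordClass_eq_of_append_comm]

theorem wordClass_wordK_negRev (l : List (ZMod k)) :
    wordClass (wordK m (negRev l)) = wordClass (wordK m l) := by
  rw [wordK, wordK, negRev_negRev, wordClass_eq_of_append_comm]

/-- A geodesic reciprocal at the cone point of order two passes through it in two directions,
which accounts for the lists `l` and `negRev l`; there are no other coincidences, except among
symmetric lists. -/
theorem eq_or_of_wordClass_wordTwo_eq (hk : 3 ≤ k) {l l' : List (ZMod k)} (hl : l ≠ [])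
    (hl0 : ∀ x ∈ l, x ≠ 0) (hl0' : ∀ x ∈ l', x ≠ 0)
    (h : wordClass (wordTwo l) = wordClass (wordTwo l')) :
    l' = l ∨ l' = negRev l ∨ negRev l = l := by
  obtain ⟨hlen, d, hd⟩ := periodic_eq_of_wordClass_eq hk (by simp [wordTwo, hl])
    (ne_zero_of_mem_wordTwo hl0) (ne_zero_of_mem_wordTwo hl0') h
  have hlen2 : l'.length = l.length := by
    simp only [wordTwo, List.length_append, length_negRev] at hlen; omega
  have hlen3 : ∀ l₁ l₂ : List (ZMod k), l₁.length = l₂.length →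
      (wordTwo l₁).length = (wordTwo l₂).length := fun l₁ l₂ h => by simp [wordTwo, h]
  rcases shift_trichotomy (periodic_wordTwo_neg l) (periodic_wordTwo_neg l') hd
    (periodic_wordTwo_period l) with h1 | h1 | h1
  · exact .inl (wordTwo_injective (eq_of_periodic_eq (hlen3 _ _ hlen2) h1))
  · simp only [periodic_wordTwo_add] at h1
    exact .inr (.inl (wordTwo_injective (eq_of_periodic_eq (hlen3 _ _ (by simpa using hlen2)) h1)))
  · simp only [periodic_wordTwo_add] at h1
    exact .inr (.inr (wordTwo_injective (eq_of_periodic_eq (hlen3 _ _ (by simp)) h1)))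

theorem eq_or_of_wordClass_wordK_eq (hm : 2 ≤ m) {l l' : List (ZMod (2 * m))}
    (hl0 : ∀ x ∈ l, x ≠ 0) (hl0' : ∀ x ∈ l', x ≠ 0)
    (h : wordClass (wordK m l) = wordClass (wordK m l')) :
    l' = l ∨ l' = negRev l ∨ negRev l = l := by
  obtain ⟨hlen, d, hd⟩ := periodic_eq_of_wordClass_eq (by omega) (by simp [wordK])
    (ne_zero_of_mem_wordK (by omega) hl0) (ne_zero_of_mem_wordK (by omega) hl0') h
  have hlen2 : l'.length = l.length := by
    simp only [wordK, List.length_append, length_negRev, List.length_cons] at hlen; omega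
  have hlen3 : ∀ l₁ l₂ : List (ZMod (2 * m)), l₁.length = l₂.length →
      (wordK m l₁).length = (wordK m l₂).length := fun l₁ l₂ h => by simp [wordK, h]
  rcases shift_trichotomy (c := 0) (fun i => by rw [zero_sub, periodic_wordK_neg])
    (fun i => by rw [zero_sub, periodic_wordK_neg]) hd
    (periodic_wordK_period m l) with h1 | h1 | h1
  · exact .inl (wordK_injective (eq_of_periodic_eq (hlen3 _ _ hlen2) h1))
  · simp only [periodic_wordK_add] at h1
    exact .inr (.inl (wordK_injective (eq_of_periodic_eq (hlen3 _ _ (by simpa using hlen2)) h1)))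
  · simp only [periodic_wordK_add] at h1
    exact .inr (.inr (wordK_injective (eq_of_periodic_eq (hlen3 _ _ (by simp)) h1)))

/-- A geodesic which is reciprocal at both cone points comes from a symmetric list. -/
theorem negRev_eq_of_wordClass_eq (hm : 2 ≤ m) {l l' : List (ZMod (2 * m))} (hl : l ≠ [])
    (hl0 : ∀ x ∈ l, x ≠ 0) (hl0' : ∀ x ∈ l', x ≠ 0)
    (h : wordClass (wordTwo l) = wordClass (wordK m l')) : negRev l = l := by
  obtain ⟨hlen, d, hd⟩ := periodic_eq_of_wordClass_eq (by omega) (by simp [wordTwo, hl])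
    (ne_zero_of_mem_wordTwo hl0) (ne_zero_of_mem_wordK (by omega) hl0') h
  have h1 := half_period_of_odd_shift (periodic_wordTwo_neg l) (periodic_wordK_neg l') hd
    (periodic_wordTwo_period l)
  simp only [periodic_wordTwo_add] at h1
  exact wordTwo_injective (eq_of_periodic_eq (by simp [wordTwo]) h1)

end geodesics

/-! ### Counting reduced words -/

section counting

variable {k : ℕ} [NeZero k]

theorem finite_words (k : ℕ) [NeZero k] (t : ℕ) :
    {l : List (ZMod k) | (∀ x ∈ l, x ≠ 0) ∧ weight l = t}.Finite := by
  refine (List.finite_length_le (ZMod k) t).subset fun l hl => ?_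
  rw [Set.mem_ofPred_eq, ← hl.2, weight_eq]
  omega

/-- The reduced lists of exponents of weight `t`. -/
noncomputable def words (k : ℕ) [NeZero k] (t : ℕ) : Finset (List (ZMod k)) :=
  (finite_words k t).toFinset

theorem mem_words {t : ℕ} {l : List (ZMod k)} :
    l ∈ words k t ↔ (∀ x ∈ l, x ≠ 0) ∧ weight l = t := by
  simp [words]

theorem words_zero : words k 0 = {[]} := by
  ext l
  rw [mem_words, Finset.mem_singleton]
  constructor
  · rintro ⟨-, h⟩
    rw [weight_eq] at h
    exact List.eq_nil_of_length_eq_zero (by omega)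
  · rintro rfl
    simp

theorem card_words_of_pos {t : ℕ} (ht : 0 < t) : (words k t).card =
    ∑ x : ZMod k, if x ≠ 0 ∧ syllable x + 1 ≤ t then (words k (t - (syllable x + 1))).card
      else 0 := by
  classical
  rw [← Finset.sum_filter]
  have : words k t = (Finset.univ.filter fun x : ZMod k => x ≠ 0 ∧ syllable x + 1 ≤ t).biUnion
      fun x => (words k (t - (syllable x + 1))).image (List.cons x) := by
    ext l
    simp only [Finset.mem_biUnion, Finset.mem_filter, Finset.mem_univ, true_and, Finset.mem_image,
      mem_words]
    constructor
    · rintro ⟨h0, hw⟩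
      cases l with
      | nil => simp at hw; omega
      | cons x l =>
        simp only [List.mem_cons, forall_eq_or_imp] at h0
        rw [weight_cons] at hw
        exact ⟨x, ⟨h0.1, by omega⟩, l, ⟨h0.2, by omega⟩, rfl⟩
    · rintro ⟨x, ⟨hx, hle⟩, l, ⟨h0, hw⟩, rfl⟩
      simp only [List.mem_cons, forall_eq_or_imp, weight_cons]
      exact ⟨⟨hx, h0⟩, by omega⟩
  rw [this, Finset.card_biUnion]
  · exact Finset.sum_congr rfl fun x _ => Finset.card_image_of_injective _ (List.cons_injective)
  · intro x _ y _ hxy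
    rw [Function.onFun, Finset.disjoint_left]
    intro l hl hl'
    simp only [Finset.mem_image] at hl hl'
    obtain ⟨u, -, rfl⟩ := hl
    obtain ⟨v, -, h⟩ := hl'
    exact hxy (List.cons.inj h).1.symm

theorem sum_range_val {M : Type*} [AddCommMonoid M] (F : ZMod k → M) :
    ∑ x : ZMod k, F x = ∑ i ∈ Finset.range k, F (i : ZMod k) := by
  refine Finset.sum_nbij' ZMod.val (fun i => (i : ZMod k)) ?_ ?_ ?_ ?_ ?_
  · intro x _; exact Finset.mem_range.mpr (ZMod.val_lt x)
  · intro i _; exact Finset.mem_univ _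
  · intro x _; simp
  · intro i hi; exact ZMod.val_cast_of_lt (Finset.mem_range.mp hi)
  · intro x _; simp

/-- Every syllable length `1, …, m - 1` is attained twice, and `m` once. -/
theorem sum_syllable {m : ℕ} (hm : 2 ≤ m) [NeZero (2 * m)] (g : ℕ → ℕ) :
    (∑ x : ZMod (2 * m), if x ≠ 0 then g (syllable x) else 0)
      = (∑ j ∈ Finset.range (m - 1), 2 * g (j + 1)) + g m := by
  obtain ⟨n, rfl⟩ : ∃ n, m = n + 1 := ⟨m - 1, by omega⟩
  have hval : ∀ i : ℕ, 0 < i → i < 2 * (n + 1) → (if (i : ZMod (2 * (n + 1))) ≠ 0 then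
      g (syllable (i : ZMod (2 * (n + 1)))) else 0) = g (min i (2 * (n + 1) - i)) := by
    intro i hi hi'
    have hv : (i : ZMod (2 * (n + 1))).val = i := ZMod.val_cast_of_lt hi'
    rw [if_pos (fun h => by rw [h, ZMod.val_zero] at hv; omega), syllable,
      ZMod.valMinAbs_natAbs_eq_min, hv]
  have hsplit : 2 * (n + 1) = (n + 1) + (n + 1) := by ring
  rw [sum_range_val]
  rw [Finset.sum_congr (s₂ := Finset.range ((n + 1) + (n + 1))) (by rw [hsplit]) (fun _ _ => rfl),
    Finset.sum_range_add, Finset.sum_range_succ', Finset.sum_range_succ',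
    ← Finset.sum_range_reflect (fun i => if ((n + 1 + (i + 1) : ℕ) : ZMod (2 * (n + 1))) ≠ 0 then
      g (syllable ((n + 1 + (i + 1) : ℕ) : ZMod (2 * (n + 1)))) else 0) n]
  have h1 : ∀ i ∈ Finset.range n, (if ((i + 1 : ℕ) : ZMod (2 * (n + 1))) ≠ 0 then
      g (syllable ((i + 1 : ℕ) : ZMod (2 * (n + 1)))) else 0) = g (i + 1) := by
    intro i hi
    have := Finset.mem_range.mp hi
    rw [hval _ (by omega) (by omega)]
    congr 1; omega
  have h2 : ∀ i ∈ Finset.range n,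
      (if ((n + 1 + (n - 1 - i + 1) : ℕ) : ZMod (2 * (n + 1))) ≠ 0 then
      g (syllable ((n + 1 + (n - 1 - i + 1) : ℕ) : ZMod (2 * (n + 1)))) else 0) = g (i + 1) := by
    intro i hi
    have := Finset.mem_range.mp hi
    rw [hval _ (by omega) (by omega)]
    congr 1; omega
  rw [Finset.sum_congr rfl h1, Finset.sum_congr rfl h2, hval (n + 1 + 0) (by omega) (by omega),
    Nat.add_sub_cancel, ← Finset.mul_sum]
  have h3 : min (n + 1 + 0) (2 * (n + 1) - (n + 1 + 0)) = n + 1 := by omega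
  rw [h3]
  simp
  ring

/-- The number of words of weight `t - s`, which is zero if `s` exceeds `t`. -/
noncomputable def cardWordsSub (k : ℕ) [NeZero k] (t s : ℕ) : ℕ :=
  if s ≤ t then (words k (t - s)).card else 0

theorem card_words_rec {m : ℕ} (hm : 2 ≤ m) [NeZero (2 * m)] {t : ℕ} (ht : 0 < t) :
    (words (2 * m) t).card = (∑ j ∈ Finset.range (m - 1), 2 * cardWordsSub (2 * m) t (j + 2))
      + cardWordsSub (2 * m) t (m + 1) := by
  rw [card_words_of_pos ht]
  refine Eq.trans ?_ (sum_syllable hm fun i => cardWordsSub (2 * m) t (i + 1))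
  refine Finset.sum_congr rfl fun x _ => ?_
  unfold cardWordsSub
  split_ifs <;> tauto

/-- Symmetric words are determined by their first half, up to a middle exponent `m`. -/
theorem card_symmetric_le {m : ℕ} [NeZero (2 * m)] (t : ℕ) :
    ((words (2 * m) t).filter fun l => negRev l = l).card
      ≤ (words (2 * m) (t / 2)).card + (words (2 * m) ((t - (m + 1)) / 2)).card := by
  classical
  have hm0 : 0 < m := by have := NeZero.ne (2 * m); omega
  have hsub : ((words (2 * m) t).filter fun l => negRev l = l)
      ⊆ (words (2 * m) (t / 2)).image (fun u => u ++ negRev u) ∪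
        (words (2 * m) ((t - (m + 1)) / 2)).image
          (fun u => u ++ ((m : ZMod (2 * m)) :: negRev u)) := by
    intro l hl
    obtain ⟨hl, hsym⟩ := Finset.mem_filter.mp hl
    obtain ⟨h0, hw⟩ := mem_words.mp hl
    rw [Finset.mem_union, Finset.mem_image, Finset.mem_image]
    rcases Nat.even_or_odd' l.length with ⟨h, hh | hh⟩
    · left
      obtain ⟨u, v, rfl, hu, hv⟩ : ∃ u v, l = u ++ v ∧ u.length = h ∧ v.length = h :=
        ⟨l.take h, l.drop h, by simp, by simp; omega, by simp; omega⟩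
      rw [negRev_append] at hsym
      have hvu : negRev u = v := (List.append_inj hsym (by simp [hu, hv])).2
      subst hvu
      refine ⟨u, mem_words.mpr ⟨fun x hx => h0 x (by simp [hx]), ?_⟩, rfl⟩
      simp at hw; omega
    · right
      obtain ⟨u, v, rfl, hu, hv⟩ : ∃ u v, l = u ++ v ∧ u.length = h ∧ v.length = h + 1 :=
        ⟨l.take h, l.drop h, by simp, by simp; omega, by simp; omega⟩
      cases v with
      | nil => simp at hv
      | cons x v =>
        rw [List.length_cons] at hv
        rw [negRev_append, negRev_cons, List.append_assoc, List.singleton_append] at hsym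
        have h1 := List.cons.inj (List.append_inj hsym (by simp [hu]; omega)).2
        have hx0 : x ≠ 0 := h0 x (by simp)
        have hxm : x = m := by
          have := ((ZMod.neg_eq_self_iff x).mp h1.1).resolve_left hx0
          rw [← ZMod.natCast_zmod_val x]
          congr 1; omega
        obtain ⟨-, h2⟩ := h1
        subst h2
        refine ⟨u, mem_words.mpr ⟨fun x hx => h0 x (by simp [hx]), ?_⟩, by rw [hxm]⟩
        rw [hxm] at hw
        simp [syllable_natCast_half hm0] at hw
        omega
  exact (Finset.card_le_card hsub).trans ((Finset.card_union_le _ _).trans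
    (add_le_add Finset.card_image_le Finset.card_image_le))

end counting

/-- A map whose fibres are the orbits of an involution, apart from its fixed points, has an image
of about half the size of its domain. -/
theorem card_image_of_involution {α β : Type*} [DecidableEq α] [DecidableEq β] (S : Finset α)
    (F : α → β) (σ : α → α) (hσS : ∀ x ∈ S, σ x ∈ S) (hσσ : ∀ x, σ (σ x) = x)
    (hFσ : ∀ x, F (σ x) = F x)
    (hF : ∀ x ∈ S, ∀ y ∈ S, F x = F y → y = x ∨ y = σ x ∨ σ x = x) :
    S.card ≤ 2 * (S.image F).card + (S.filter fun x => σ x = x).card ∧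
      2 * (S.image F).card ≤ S.card + (S.filter fun x => σ x = x).card := by
  set P := S.filter fun x => σ x = x with hP
  set T := S.filter fun x => ¬ σ x = x with hT
  have hcard : P.card + T.card = S.card := Finset.card_filter_add_card_filter_not _
  have hfib : T.card = 2 * (T.image F).card := by
    rw [Finset.card_eq_sum_card_image F T, mul_comm, ← smul_eq_mul, ← Finset.sum_const]
    refine Finset.sum_congr rfl fun y hy => ?_
    obtain ⟨x, hx, rfl⟩ := Finset.mem_image.mp hy
    obtain ⟨hxS, hxσ⟩ := Finset.mem_filter.mp hx
    have : (T.filter fun z => F z = F x) = {x, σ x} := by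
      ext z
      simp only [Finset.mem_filter, Finset.mem_insert, Finset.mem_singleton, hT]
      constructor
      · rintro ⟨⟨hzS, -⟩, hz⟩
        rcases hF x hxS z hzS hz.symm with h | h | h
        exacts [.inl h, .inr h, absurd h hxσ]
      · rintro (rfl | rfl)
        · exact ⟨⟨hxS, hxσ⟩, rfl⟩
        · exact ⟨⟨hσS x hxS, fun h => hxσ (by rw [hσσ] at h; exact h.symm)⟩, hFσ x⟩
    rw [this, Finset.card_pair (fun h => hxσ h.symm)]
  have h1 : (T.image F).card ≤ (S.image F).card :=
    Finset.card_le_card (Finset.image_subset_image (Finset.filter_subset _ _))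
  have h2 : (S.image F).card ≤ (T.image F).card + P.card := by
    have : S = T ∪ P := by rw [hT, hP, Finset.union_comm, Finset.filter_union_filter_not_eq]
    calc (S.image F).card = (T.image F ∪ P.image F).card := by
          rw [← Finset.image_union, ← this]
      _ ≤ _ := (Finset.card_union_le _ _).trans (by gcongr; exact Finset.card_image_le)
  omega

/-! ### The recurrence sequences count words -/

section sequences

variable {m : ℕ} [NeZero (2 * m)]

theorem cardWordsSub_of_le {t s : ℕ} (h : s ≤ t) :
    cardWordsSub (2 * m) t s = (words (2 * m) (t - s)).card := if_pos h

theorem cardWordsSub_of_lt {t s : ℕ} (h : t < s) : cardWordsSub (2 * m) t s = 0 :=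
  if_neg (by omega)

theorem card_words_zero : (words (2 * m) 0).card = 1 := by rw [words_zero, Finset.card_singleton]

theorem card_words_rec_real (hm : 2 ≤ m) (t : ℕ) : ((words (2 * m) (t + m + 1)).card : ℝ)
    = (∑ j ∈ Finset.Icc 1 (m - 1), 2 * ((words (2 * m) (t + j)).card : ℝ))
      + (words (2 * m) t).card := by
  rw [card_words_rec hm (by omega), cardWordsSub_of_le (by omega)]
  push_cast
  congr 1
  · refine Finset.sum_nbij' (fun j => m - 1 - j) (fun j => m - 1 - j) ?_ ?_ ?_ ?_ ?_ <;>
      simp only [Finset.mem_range, Finset.mem_Icc] <;> intro j hj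
    · omega
    · omega
    · omega
    · omega
    · rw [cardWordsSub_of_le (by omega)]
      congr 4; omega
  · congr 3; omega

/-- As long as the bound on the exponents plays no role, the number of words is given by the
recurrence `w (t + 2) = w (t + 1) + 2 * w t`. -/
theorem card_words_of_le (hm : 2 ≤ m) {t : ℕ} (ht : t ≤ m) :
    ((words (2 * m) t).card : ℝ) = (2 ^ t + 2 * (-1) ^ t) / 3 := by
  have hsum : ∀ n : ℕ, ∑ s ∈ Finset.range n, 2 * (((2 : ℝ) ^ s + 2 * (-1) ^ s) / 3)
      = (2 ^ (n + 1) + 2 * (-1) ^ (n + 1)) / 3 := by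
    intro n
    induction n with
    | zero => norm_num
    | succ n ih => rw [Finset.sum_range_succ, ih]; ring
  induction t using Nat.strong_induction_on with
  | _ t ih =>
    rcases Nat.eq_zero_or_pos t with rfl | hpos
    · rw [card_words_zero]; norm_num
    · obtain ⟨n, rfl⟩ : ∃ n, t = n + 1 := ⟨t - 1, by omega⟩
      rw [card_words_rec hm hpos, cardWordsSub_of_lt (s := m + 1) (by omega), add_zero, ← hsum n]
      push_cast
      rw [← Finset.sum_range_reflect (fun s => 2 * (((2 : ℝ) ^ s + 2 * (-1) ^ s) / 3))]
      rw [← Finset.sum_subset (Finset.range_subset_range.mpr (show n ≤ m - 1 by omega))]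
      · refine Finset.sum_congr rfl fun j hj => ?_
        have := Finset.mem_range.mp hj
        rw [cardWordsSub_of_le (by omega), ← ih (n - 1 - j) (by omega) (by omega)]
        congr 4; omega
      · intro j _ hj
        rw [Finset.mem_range] at hj
        rw [cardWordsSub_of_lt (by omega)]
        simp

theorem seqTwo_eq_card_words (hm : 2 ≤ m) {t : ℕ} (ht : 1 ≤ t) :
    seqTwo m t = (words (2 * m) t).card := by
  induction t using Nat.strong_induction_on with
  | _ t ih =>
    rw [seqTwo]
    split_ifs with h1 h2 h3 h4
    · obtain rfl : t = 1 := by omega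
      rw [card_words_of_le hm (by omega)]
      norm_num
    · rw [card_words_of_le hm (by omega)]
    · have hsum : ∀ n : ℕ, ∑ j ∈ Finset.Icc 1 n, 2 * (((2 : ℝ) ^ j + 2 * (-1) ^ j) / 3)
          = (2 ^ (n + 2) + 2 * (-1) ^ (n + 2)) / 3 - 2 := by
        intro n
        induction n with
        | zero => norm_num
        | succ n ih => rw [Finset.sum_Icc_succ_top (by omega), ih]; ring
      have h := card_words_rec_real hm 0
      rw [Finset.sum_congr rfl (fun j hj => by
        rw [card_words_of_le hm (by have := (Finset.mem_Icc.mp hj).2; omega), zero_add]),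
        hsum, card_words_zero, show m - 1 + 2 = m + 1 by omega, show 0 + m + 1 = m + 1 by omega]
        at h
      rw [h3, h]
      push_cast
      ring
    · have hsum : ∀ n : ℕ, ∑ j ∈ Finset.Icc 1 n, 2 * (((2 : ℝ) ^ (1 + j) + 2 * (-1) ^ (1 + j)) / 3)
          = (2 ^ (n + 3) + 2 * (-1) ^ (n + 3)) / 3 - 2 := by
        intro n
        induction n with
        | zero => norm_num
        | succ n ih => rw [Finset.sum_Icc_succ_top (by omega), ih]; ring
      have h := card_words_rec_real hm 1
      rw [Finset.sum_congr rfl (fun j hj => by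
        rw [card_words_of_le hm (by have := (Finset.mem_Icc.mp hj).2; omega)]),
        hsum, card_words_of_le hm (t := 1) (by omega), show m - 1 + 3 = m + 2 by omega,
        show 1 + m + 1 = m + 2 by omega] at h
      rw [h4, h]
      ring
    · rw [card_words_rec hm (by omega), Finset.sum_range]
      push_cast
      congr 1
      · refine Finset.sum_congr rfl fun j _ => ?_
        have := j.2
        rw [ih _ (by omega) (by omega), cardWordsSub_of_le (by omega)]
      · rw [ih _ (by omega) (by omega), cardWordsSub_of_le (by omega)]

theorem seqK_eq_cardWordsSub (hm : 2 ≤ m) (t : ℕ) :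
    seqK m t = cardWordsSub (2 * m) t (m + 1) := by
  induction t using Nat.strong_induction_on with
  | _ t ih =>
    rw [seqK]
    split_ifs with h1 h2 h3 h4
    · rw [cardWordsSub_of_lt h1]; simp
    · rw [cardWordsSub_of_le (by omega), h2, Nat.sub_self, card_words_zero]; simp
    · rw [cardWordsSub_of_le (by omega), h3, show m + 2 - (m + 1) = 1 by omega,
        card_words_of_le hm (by omega)]
      norm_num
    · rw [cardWordsSub_of_le (by omega), h4, show m + 3 - (m + 1) = 2 by omega,
        card_words_of_le hm (by omega)]
      norm_num
    · rw [cardWordsSub_of_le (by omega), card_words_rec hm (by omega), Finset.sum_range]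
      push_cast
      have e : ∀ s, s ≤ m + 1 → (cardWordsSub (2 * m) (t - s) (m + 1) : ℝ)
          = cardWordsSub (2 * m) (t - (m + 1)) s := by
        intro s hs
        unfold cardWordsSub
        rw [Nat.sub_right_comm]
        congr 1
        exact if_congr (by omega) rfl rfl
      congr 1
      · refine Finset.sum_congr rfl fun j _ => ?_
        have := j.2
        rw [ih _ (by omega), e _ (by omega)]
      · rw [ih _ (by omega), e _ le_rfl]

theorem card_words_pos (hm : 2 ≤ m) {t : ℕ} (ht : 2 ≤ t) : 0 < (words (2 * m) t).card := by
  have h2 : ∀ t, 2 ≤ t → 0 < (words (2 * m) (t - 2)).card → 0 < (words (2 * m) t).card := by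
    intro t ht h
    rw [card_words_rec hm (by omega)]
    refine Nat.add_pos_left (Finset.sum_pos' (fun _ _ => Nat.zero_le _)
      ⟨0, Finset.mem_range.mpr (by omega), ?_⟩) _
    rw [cardWordsSub_of_le (by omega)]
    exact Nat.mul_pos two_pos h
  have h3 : 0 < (words (2 * m) 3).card := by
    rcases hm.eq_or_lt with rfl | hm'
    · rw [card_words_rec le_rfl (by omega), cardWordsSub_of_le (s := 3) le_rfl, Nat.sub_self,
        card_words_zero]
      omega
    · have := card_words_of_le hm (t := 3) hm'
      norm_num at this
      rw [show (words (2 * m) 3).card = 2 by exact_mod_cast this]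
      omega
  induction t using Nat.strong_induction_on with
  | _ t ih =>
    rcases (show t = 2 ∨ t = 3 ∨ 4 ≤ t by omega) with rfl | rfl | h4
    · exact h2 2 le_rfl (by rw [Nat.sub_self, card_words_zero]; omega)
    · exact h3
    · exact h2 t ht (ih (t - 2) (by omega) (by omega))

theorem card_words_le_pow (hm : 2 ≤ m) {β : ℝ} (hβ : 0 < β) (h : (heckePoly ℝ m).IsRoot β) (t : ℕ) :
    ((words (2 * m) t).card : ℝ) ≤ β ^ t := by
  induction t using Nat.strong_induction_on with
  | _ t ih =>
    rcases Nat.eq_zero_or_pos t with rfl | hpos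
    · rw [card_words_zero]; simp
    · -- after multiplication by `β ^ (m + 1)` this is the equation of the root
      have hsub : ∀ s, 1 ≤ s → s ≤ m + 1 →
          β ^ (m + 1) * (cardWordsSub (2 * m) t s : ℝ) ≤ β ^ t * β ^ (m + 1 - s) := by
        intro s hs hs'
        rcases le_or_gt s t with hst | hst
        · rw [cardWordsSub_of_le hst]
          calc β ^ (m + 1) * ((words (2 * m) (t - s)).card : ℝ) ≤ β ^ (m + 1) * β ^ (t - s) := by
                gcongr
                exact ih _ (by omega)
            _ = _ := by rw [← pow_add, ← pow_add]; congr 1; omega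
        · rw [cardWordsSub_of_lt hst, Nat.cast_zero, mul_zero]
          positivity
      have key : β ^ (m + 1) * ((words (2 * m) t).card : ℝ) ≤ β ^ t * β ^ (m + 1) := by
        rw [card_words_rec hm hpos]
        push_cast
        rw [mul_add, Finset.mul_sum]
        have h1 : ∑ j ∈ Finset.range (m - 1),
            β ^ (m + 1) * (2 * (cardWordsSub (2 * m) t (j + 2) : ℝ))
            ≤ β ^ t * ∑ j ∈ Finset.Icc 1 (m - 1), 2 * β ^ j := by
          rw [Finset.mul_sum]
          calc _ ≤ ∑ j ∈ Finset.range (m - 1), 2 * (β ^ t * β ^ (m - 1 - j)) := by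
                refine Finset.sum_le_sum fun j hj => ?_
                have h2 := hsub (j + 2) (by omega) (by have := Finset.mem_range.mp hj; omega)
                rw [show m + 1 - (j + 2) = m - 1 - j by omega] at h2
                linarith
            _ = _ := by
                refine Finset.sum_nbij' (fun j => m - 1 - j) (fun j => m - 1 - j) ?_ ?_ ?_ ?_ ?_ <;>
                  simp only [Finset.mem_range, Finset.mem_Icc] <;> intro j hj
                · omega
                · omega
                · omega
                · omega
                · ring
        have h2 := hsub (m + 1) (by omega) le_rfl
        rw [Nat.sub_self, pow_zero] at h2
        have h3 := isRoot_heckePoly_iff.mp h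
        have h4 : β ^ t * β ^ (m + 1)
            = β ^ t * (∑ j ∈ Finset.Icc 1 (m - 1), 2 * β ^ j) + β ^ t * 1 := by
          rw [h3]; ring
        linarith
      rw [mul_comm] at key
      exact le_of_mul_le_mul_right key (by positivity)

end sequences

/-! ### Counting reciprocal geodesics -/

section counts

variable {m : ℕ} [NeZero (2 * m)]

/-- The number of symmetric words of weight `t`. -/
noncomputable def cardSymmetric (m : ℕ) [NeZero (2 * m)] (t : ℕ) : ℕ :=
  ((words (2 * m) t).filter fun l => negRev l = l).card

open Classical in
theorem setOf_two_eq (hm : 2 ≤ m) {t : ℕ} (ht : 1 ≤ t) :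
    {γ | γ ∈ reciprocalGeodesics (conePointTwo (2 * m)) ∧ classLength γ = 2 * t}
      = ((words (2 * m) t).image fun l => wordClass (wordTwo l) : Finset _) := by
  have hk : 3 ≤ 2 * m := by omega
  have hne : ∀ l : List (ZMod (2 * m)), l ≠ [] → wordTwo l ≠ [] := fun l hl => by
    simp [wordTwo, hl]
  ext γ
  simp only [Set.mem_ofPred_eq, Finset.coe_image, Set.mem_image, Finset.mem_coe, mem_words,
    mem_reciprocal_two_iff hk]
  constructor
  · rintro ⟨⟨l, hl, hl0, rfl⟩, hlen⟩
    rw [classLength_wordClass hk (hne l hl) (ne_zero_of_mem_wordTwo hl0), weight_wordTwo] at hlen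
    exact ⟨l, ⟨hl0, by omega⟩, rfl⟩
  · rintro ⟨l, ⟨hl0, hw⟩, rfl⟩
    have hl : l ≠ [] := by rintro rfl; simp at hw; omega
    refine ⟨⟨l, hl, hl0, rfl⟩, ?_⟩
    rw [classLength_wordClass hk (hne l hl) (ne_zero_of_mem_wordTwo hl0), weight_wordTwo, hw]

open Classical in
theorem setOf_k_eq (hm : 2 ≤ m) (hk : 3 ≤ 2 * m) {t : ℕ} (ht : m + 1 ≤ t) :
    {γ | γ ∈ reciprocalGeodesics (conePointK (2 * m) hk) ∧ classLength γ = 2 * t}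
      = ((words (2 * m) (t - (m + 1))).image fun l => wordClass (wordK m l) : Finset _) := by
  have hne : ∀ l : List (ZMod (2 * m)), wordK m l ≠ [] := fun l => by simp [wordK]
  ext γ
  simp only [Set.mem_ofPred_eq, Finset.coe_image, Set.mem_image, Finset.mem_coe, mem_words,
    mem_reciprocal_k_iff hm hk]
  constructor
  · rintro ⟨⟨l, hl0, rfl⟩, hlen⟩
    rw [classLength_wordClass hk (hne l) (ne_zero_of_mem_wordK (by omega) hl0),
      weight_wordK (by omega)] at hlen
    exact ⟨l, ⟨hl0, by omega⟩, rfl⟩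
  · rintro ⟨l, ⟨hl0, hw⟩, rfl⟩
    refine ⟨⟨l, hl0, rfl⟩, ?_⟩
    rw [classLength_wordClass hk (hne l) (ne_zero_of_mem_wordK (by omega) hl0),
      weight_wordK (by omega), hw]
    omega

theorem negRev_mem_words {t : ℕ} {l : List (ZMod (2 * m))} (hl : l ∈ words (2 * m) t) :
    negRev l ∈ words (2 * m) t := by
  rw [mem_words] at hl ⊢
  exact ⟨ne_zero_of_mem_negRev hl.1, by rw [weight_negRev, hl.2]⟩

theorem count_two_bounds (hm : 2 ≤ m) {t : ℕ} (ht : 1 ≤ t) :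
    (words (2 * m) t).card
        ≤ 2 * countOfLength (reciprocalGeodesics (conePointTwo (2 * m))) (2 * t)
          + cardSymmetric m t ∧
      2 * countOfLength (reciprocalGeodesics (conePointTwo (2 * m))) (2 * t)
        ≤ (words (2 * m) t).card + cardSymmetric m t := by
  classical
  rw [countOfLength, setOf_two_eq hm ht, Set.ncard_coe_finset]
  refine card_image_of_involution _ _ negRev (fun l hl => negRev_mem_words hl) negRev_negRev
    wordClass_wordTwo_negRev fun l hl l' hl' h => ?_
  rw [mem_words] at hl hl'
  exact eq_or_of_wordClass_wordTwo_eq (by omega) (by rintro rfl; simp at hl; omega) hl.1 hl'.1 h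

theorem count_k_bounds (hm : 2 ≤ m) (hk : 3 ≤ 2 * m) {t : ℕ} (ht : m + 1 ≤ t) :
    (words (2 * m) (t - (m + 1))).card
        ≤ 2 * countOfLength (reciprocalGeodesics (conePointK (2 * m) hk)) (2 * t)
          + cardSymmetric m (t - (m + 1)) ∧
      2 * countOfLength (reciprocalGeodesics (conePointK (2 * m) hk)) (2 * t)
        ≤ (words (2 * m) (t - (m + 1))).card + cardSymmetric m (t - (m + 1)) := by
  classical
  rw [countOfLength, setOf_k_eq hm hk ht, Set.ncard_coe_finset]
  refine card_image_of_involution _ _ negRev (fun l hl => negRev_mem_words hl) negRev_negRev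
    wordClass_wordK_negRev fun l hl l' hl' h => ?_
  rw [mem_words] at hl hl'
  exact eq_or_of_wordClass_wordK_eq hm hl.1 hl'.1 h

theorem count_all_bounds (hm : 2 ≤ m) (hk : 3 ≤ 2 * m) {t : ℕ} (ht : m + 1 ≤ t) :
    countOfLength (reciprocalGeodesics (conePointTwo (2 * m))) (2 * t)
      + countOfLength (reciprocalGeodesics (conePointK (2 * m) hk)) (2 * t)
        ≤ countOfLength (allReciprocalGeodesics (2 * m) hk) (2 * t)
          + cardSymmetric m t ∧
    countOfLength (allReciprocalGeodesics (2 * m) hk) (2 * t)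
      ≤ countOfLength (reciprocalGeodesics (conePointTwo (2 * m))) (2 * t)
        + countOfLength (reciprocalGeodesics (conePointK (2 * m) hk)) (2 * t) := by
  classical
  have hunion : {γ | γ ∈ allReciprocalGeodesics (2 * m) hk ∧ classLength γ = 2 * t}
      = {γ | γ ∈ reciprocalGeodesics (conePointTwo (2 * m)) ∧ classLength γ = 2 * t}
        ∪ {γ | γ ∈ reciprocalGeodesics (conePointK (2 * m) hk)
          ∧ classLength γ = 2 * t} := by
    ext γ
    simp only [allReciprocalGeodesics, Set.mem_union, Set.mem_ofPred_eq]
    tauto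
  rw [countOfLength, countOfLength, countOfLength, hunion, setOf_two_eq hm (by omega),
    setOf_k_eq hm hk ht, ← Finset.coe_union, Set.ncard_coe_finset, Set.ncard_coe_finset,
    Set.ncard_coe_finset]
  set S := (words (2 * m) t).image fun l => wordClass (wordTwo l)
  set T := (words (2 * m) (t - (m + 1))).image fun l => wordClass (wordK m l)
  have h1 := Finset.card_union_add_card_inter S T
  have h2 : (S ∩ T).card ≤ cardSymmetric m t := by
    have hsub : S ∩ T ⊆ ((words (2 * m) t).filter fun l => negRev l = l).image
        fun l => wordClass (wordTwo l) := by
      intro γ hγ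
      obtain ⟨h3, h4⟩ := Finset.mem_inter.mp hγ
      obtain ⟨l, hl, rfl⟩ := Finset.mem_image.mp h3
      obtain ⟨l', hl', h⟩ := Finset.mem_image.mp h4
      refine Finset.mem_image.mpr ⟨l, Finset.mem_filter.mpr ⟨hl, ?_⟩, rfl⟩
      rw [mem_words] at hl hl'
      exact negRev_eq_of_wordClass_eq hm (by rintro rfl; simp at hl; omega) hl.1 hl'.1 h.symm
    exact (Finset.card_le_card hsub).trans Finset.card_image_le
  omega

theorem cardSymmetric_le (hm : 2 ≤ m) {β : ℝ} (hβ : 0 < β) (h : (heckePoly ℝ m).IsRoot β) {s t : ℕ}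
    (hst : s ≤ t) : (cardSymmetric m s : ℝ) ≤ 2 * β ^ (t / 2) := by
  have h1 : (1 : ℝ) ≤ β := (one_lt_root hm hβ h).le
  have h2 : (cardSymmetric m s : ℝ) ≤
      (words (2 * m) (s / 2)).card + (words (2 * m) ((s - (m + 1)) / 2)).card := by
    exact_mod_cast card_symmetric_le s
  have h3 := card_words_le_pow hm hβ h (s / 2)
  have h4 := card_words_le_pow hm hβ h ((s - (m + 1)) / 2)
  have h5 : β ^ (s / 2) ≤ β ^ (t / 2) := pow_le_pow_right₀ h1 (by omega)
  have h6 : β ^ ((s - (m + 1)) / 2) ≤ β ^ (t / 2) := pow_le_pow_right₀ h1 (by omega)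
  linarith

end counts

theorem tendsto_div_pow_of_abs_sub_le {β : ℝ} (hβ : 1 < β) {u v : ℕ → ℝ} {L : ℝ}
    (huv : ∀ᶠ t in atTop, |u t - v t| ≤ 2 * β ^ (t / 2))
    (hv : Tendsto (fun t => v t / β ^ t) atTop (𝓝 L)) :
    Tendsto (fun t => u t / β ^ t) atTop (𝓝 L) := by
  have hβ0 : 0 < β := by linarith
  have h1 : Tendsto (fun t : ℕ => 2 * (β⁻¹) ^ (t / 2)) atTop (𝓝 0) := by
    have h2 := (tendsto_pow_atTop_nhds_zero_of_lt_one (inv_nonneg.mpr hβ0.le)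
      (inv_lt_one_of_one_lt₀ hβ)).comp (Nat.tendsto_div_const_atTop (two_ne_zero))
    simpa using h2.const_mul 2
  have h3 : Tendsto (fun t => u t / β ^ t - v t / β ^ t) atTop (𝓝 0) := by
    refine squeeze_zero_norm' ?_ h1
    filter_upwards [huv] with t ht
    rw [← sub_div, norm_div, Real.norm_eq_abs, Real.norm_of_nonneg (by positivity), inv_pow,
      div_le_iff₀ (by positivity)]
    refine ht.trans ?_
    have h4 : β ^ (t / 2) * β ^ (t / 2) ≤ β ^ t := by
      rw [← pow_add]
      exact pow_le_pow_right₀ hβ.le (by omega)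
    have h5 : 0 < β ^ (t / 2) := by positivity
    rw [mul_assoc]
    gcongr
    rwa [inv_mul_eq_div, le_div_iff₀ h5]
  simpa using h3.add hv

end Hecke

open Hecke
theorem corollaryC (m : ℕ) (hm : 2 ≤ m) :
    (∃! β : ℝ, 0 < β ∧ (heckePoly ℝ m).IsRoot β) ∧
    ∀ β : ℝ, 0 < β → (heckePoly ℝ m).IsRoot β →
      (∃! d : ℝ, IsCoefficient m (seqTwo m) 2 β d) ∧
      (∃! e : ℝ, IsCoefficient m (seqK m) (m + 1) β e) ∧
      ∀ d e : ℝ, IsCoefficient m (seqTwo m) 2 β d → IsCoefficient m (seqK m) (m + 1) β e →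
        0 < d ∧ 0 < e ∧
        Tendsto (fun t : ℕ =>
            (countOfLength (reciprocalGeodesics (conePointK (2 * m) (by omega))) (2 * t) : ℝ) /
              (countOfLength (reciprocalGeodesics (conePointTwo (2 * m))) (2 * t) : ℝ))
          atTop (𝓝 (e / d)) ∧
        Tendsto (fun t : ℕ =>
            (countOfLength (allReciprocalGeodesics (2 * m) (by omega)) (2 * t) : ℝ) / β ^ t)
          atTop (𝓝 ((d + e) / 2)) := by
  have : NeZero (2 * m) := ⟨by omega⟩
  obtain ⟨β₀, hβ₀, hr₀⟩ := exists_heckePoly_root hm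
  refine ⟨⟨β₀, ⟨hβ₀, hr₀⟩, fun y hy => heckePoly_root_unique hy.1 hβ₀ hy.2 hr₀⟩, ?_⟩
  intro β hβ hr
  have hβ1 := one_lt_root hm hβ hr
  obtain ⟨a, ha⟩ := exists_coefficients hm (fun t => ((words (2 * m) t).card : ℝ))
    (card_words_rec_real hm)
  refine ⟨existsUnique_isCoefficient hm hβ hr (a := a) fun t ht => ?_,
    existsUnique_isCoefficient hm hβ hr (a := fun z => a z / z ^ (m + 1)) fun t ht => ?_, ?_⟩
  · rw [seqTwo_eq_card_words hm (by omega), ha]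
  · rw [seqK_eq_cardWordsSub hm, cardWordsSub_of_le ht, ha]
    refine Finset.sum_congr rfl fun z hz => ?_
    have hz0 := ne_zero_of_mem_roots hm hz
    obtain ⟨n, rfl⟩ : ∃ n, t = n + (m + 1) := ⟨t - (m + 1), by omega⟩
    rw [Nat.add_sub_cancel, pow_add]
    field_simp
    ring
  intro d e hd he
  have hd' := hd.tendsto hm hβ hr
  have he' := he.tendsto hm hβ hr
  -- positivity of the coefficients
  obtain ⟨c, hc, hle⟩ := exists_pos_mul_pow_le hβ hr
    (W := fun t => ((words (2 * m) t).card : ℝ)) (card_words_rec_real hm) (t₀ := 2)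
    fun t ht => by exact_mod_cast card_words_pos hm ht
  have hdpos : 0 < d := by
    refine hc.trans_le (ge_of_tendsto hd' ?_)
    filter_upwards [eventually_ge_atTop 2] with t ht
    rw [le_div_iff₀ (by positivity), seqTwo_eq_card_words hm (by omega)]
    exact hle t ht
  have hepos : 0 < e := by
    refine (div_pos hc (pow_pos hβ (m + 1))).trans_le (ge_of_tendsto he' ?_)
    filter_upwards [eventually_ge_atTop (m + 3)] with t ht
    rw [le_div_iff₀ (by positivity), seqK_eq_cardWordsSub hm, cardWordsSub_of_le (by omega)]
    refine le_trans (le_of_eq ?_) (hle (t - (m + 1)) (by omega))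
    rw [div_mul_eq_mul_div, div_eq_iff (by positivity), mul_assoc, ← pow_add,
      Nat.sub_add_cancel (by omega)]
  -- the counts agree with half the sequences, up to the number of symmetric words
  have hTwo : Tendsto (fun t : ℕ =>
      (countOfLength (reciprocalGeodesics (conePointTwo (2 * m))) (2 * t) : ℝ) / β ^ t)
      atTop (𝓝 (d / 2)) := by
    refine tendsto_div_pow_of_abs_sub_le hβ1 (v := fun t => seqTwo m t / 2) ?_
      ((hd'.div_const 2).congr fun t => by ring)
    filter_upwards [eventually_ge_atTop 1] with t ht
    obtain ⟨h1, h2⟩ := count_two_bounds hm ht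
    have h3 := cardSymmetric_le hm hβ hr (le_refl t)
    have h4 : (0 : ℝ) ≤ cardSymmetric m t := by positivity
    rw [seqTwo_eq_card_words hm ht]
    have h1' := (Nat.cast_le (α := ℝ)).mpr h1
    have h2' := (Nat.cast_le (α := ℝ)).mpr h2
    push_cast at h1' h2'
    rw [abs_le]
    constructor <;> linarith
  have hK : Tendsto (fun t : ℕ =>
      (countOfLength (reciprocalGeodesics (conePointK (2 * m) (by omega))) (2 * t) : ℝ) / β ^ t)
      atTop (𝓝 (e / 2)) := by
    refine tendsto_div_pow_of_abs_sub_le hβ1 (v := fun t => seqK m t / 2) ?_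
      ((he'.div_const 2).congr fun t => by ring)
    filter_upwards [eventually_ge_atTop (m + 1)] with t ht
    obtain ⟨h1, h2⟩ := count_k_bounds hm (by omega) ht
    have h3 := cardSymmetric_le hm hβ hr (Nat.sub_le t (m + 1))
    have h4 : (0 : ℝ) ≤ cardSymmetric m (t - (m + 1)) := by positivity
    rw [seqK_eq_cardWordsSub hm, cardWordsSub_of_le ht]
    have h1' := (Nat.cast_le (α := ℝ)).mpr h1
    have h2' := (Nat.cast_le (α := ℝ)).mpr h2
    push_cast at h1' h2'
    rw [abs_le]
    constructor <;> linarith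
  refine ⟨hdpos, hepos, ?_, ?_⟩
  · have h := hK.div hTwo (by positivity)
    have e1 : e / 2 / (d / 2) = e / d := by field_simp
    rw [e1] at h
    refine h.congr fun t => ?_
    have : β ^ t ≠ 0 := by positivity
    simp only [Pi.div_apply]
    rw [div_div_div_cancel_right₀ this]
  · refine tendsto_div_pow_of_abs_sub_le hβ1 (v := fun t =>
      (countOfLength (reciprocalGeodesics (conePointTwo (2 * m))) (2 * t) : ℝ)
      + (countOfLength (reciprocalGeodesics (conePointK (2 * m) (by omega))) (2 * t) : ℝ)) ?_ ?_
    · filter_upwards [eventually_ge_atTop (m + 1)] with t ht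
      obtain ⟨h1, h2⟩ := count_all_bounds hm (by omega) ht
      have h3 := cardSymmetric_le hm hβ hr (le_refl t)
      have h4 : (0 : ℝ) ≤ β ^ (t / 2) := by positivity
      rw [abs_le]
      have h1' := (Nat.cast_le (α := ℝ)).mpr h1
      have h2' := (Nat.cast_le (α := ℝ)).mpr h2
      push_cast at h1' h2'
      constructor <;> linarith
    · have h := hTwo.add hK
      rw [← add_div] at h
      exact h.congr fun t => by ring
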